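/- Let $H=-\frac{d^2}{dx^2}+x^2$ be the harmonic oscillator on $L^2(\mathbb R)$, i.e. the closure of this operator with domain the Schwartz space $\mathcal S(\mathbb R)$. For a bounded operator $T$ on a Hilbert space let $s_0(T)\ge s_1(T)\ge\cdots$ be its singular values, $s_k(T)=\inf\{\|T-F\| : \operatorname{rank}F\le k\}$, and let $\mathcal L^{(1,\infty)}$ be the ideal of compact operators $T$ with $\sup_{n\ge 0}\frac{1}{\log(n+2)}\sum_{k=0}^{n}s_k(T)<\infty$. Let $\omega$ be a positive linear functional on the bounded real sequences with $\omega(a)=\lim_n a_n$ whenever $a$ converges, and $\omega(a_0,a_0,a_1,a_1,\dots)=\omega(a_0,a_1,\dots)$ for all $a$. The Dixmier trace $\mathrm{Tr}_\omega$ is the linear functional on $\mathcal L^{(1,\infty)}$ determined by $\mathrm{Tr}_\omega(T)=\omega\Big(\Big(\frac{1}{\log(n+2)}\sum_{k=0}^{n}s_k(T)\Big)_{n\ge0}\Big)$ for positive $T$; explicitly $\mathrm{Tr}_\omega(T)=\mathrm{Tr}_\omega((\operatorname{Re}T)_+)-\mathrm{Tr}_\omega((\operatorname{Re}T)_-)+i\,\mathrm{Tr}_\omega((\operatorname{Im}T)_+)-i\,\mathrm{Tr}_\omega((\operatorname{Im}T)_-)$.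 Let $f:\mathbb R\to\mathbb C$ be bounded and uniformly continuous, acting on $L^2(\mathbb R)$ by multiplication, and suppose that $f$ has the asymptotic mean property: the limits $\mu_{\pm}=\lim_{x\to\pm\infty}\frac1x\int_0^x f(u)\,du$ exist. Put $\mu(f)=\frac12\mu_-+\frac12\mu_+$. Then $H$ has a bounded inverse $H^{-1}$ on $L^2(\mathbb R)$, the operator $fH^{-1}$ belongs to $\mathcal L^{(1,\infty)}$, and for every such $\omega$ $$\mathrm{Tr}_\omega(fH^{-1})=\frac{\mu(f)}{2}.$$ -/

import Mathlib

open MeasureTheory Filter Topology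
open scoped ENNReal BoundedContinuousFunction SchwartzMap ComplexStarModule

noncomputable section

namespace HarmonicDixmier

/-! ### Singular values and the Dixmier trace -/

section Dixmier

variable {E : Type*} [NormedAddCommGroup E] [InnerProductSpace ℂ E] [CompleteSpace E]

/-- The `k`-th singular value (`k = 0, 1, 2, …`) of a bounded operator on a Hilbert space: the
distance in operator norm to the operators of rank at most `k`. For a compact operator these are
the eigenvalues of `|T|` in decreasing order, repeated according to multiplicity. -/
def singularValue (T : E →L[ℂ] E) (k : ℕ) : ℝ :=
  sInf {r : ℝ | ∃ F : E →L[ℂ] E, (F : E →ₗ[ℂ] E).rank ≤ (k : Cardinal) ∧ r = ‖T - F‖}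

/-- The logarithmic means `(s₀(T) + ⋯ + sₙ(T)) / log (n + 2)`. -/
def logMean (T : E →L[ℂ] E) (n : ℕ) : ℝ :=
  (∑ k ∈ Finset.range (n + 1), singularValue T k) / Real.log (n + 2)

/-- The Dixmier ideal `𝓛^(1,∞)`: compact operators with bounded logarithmic means. -/
def MemDixmierIdeal (T : E →L[ℂ] E) : Prop :=
  IsCompactOperator T ∧ ∃ C : ℝ, ∀ n, |logMean T n| ≤ C

/-- The functionals `ω` used to define Dixmier traces: positive linear forms on the bounded real
sequences which extend the limit and satisfy
`ω(a₀, a₀, a₁, a₁, a₂, a₂, …) = ω(a₀, a₁, a₂, …)`. -/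
structure DixmierLimit where
  /-- the underlying linear form on bounded sequences -/
  toLinearMap : (ℕ →ᵇ ℝ) →ₗ[ℝ] ℝ
  nonneg : ∀ a : ℕ →ᵇ ℝ, (∀ n, 0 ≤ a n) → 0 ≤ toLinearMap a
  eq_lim : ∀ (a : ℕ →ᵇ ℝ) (l : ℝ), Tendsto a atTop (𝓝 l) → toLinearMap a = l
  dilation : ∀ a b : ℕ →ᵇ ℝ, (∀ n, b n = a (n / 2)) → toLinearMap b = toLinearMap a

open Classical in
/-- `ω` applied to the sequence of logarithmic means of `T`. For positive `T` in the Dixmier ideal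
this is the Dixmier trace of `T`; it has the value `0` if the means are unbounded. -/
def dixmierTracePos (ω : DixmierLimit) (T : E →L[ℂ] E) : ℝ :=
  if h : ∃ C : ℝ, ∀ n, |logMean T n| ≤ C then
    ω.toLinearMap (BoundedContinuousFunction.ofNormedAddCommGroupDiscrete (logMean T) h.choose
      (fun n => by simpa [Real.norm_eq_abs] using h.choose_spec n))
  else 0

/-- The Dixmier trace of a self-adjoint operator, from the Jordan decomposition `T = T⁺ - T⁻`. -/
def dixmierTraceSA (ω : DixmierLimit) (T : E →L[ℂ] E) : ℝ :=
  dixmierTracePos ω T⁺ - dixmierTracePos ω T⁻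

/-- The Dixmier trace `Tr_ω`, the complex linear extension from the positive operators of the
Dixmier ideal to the whole ideal, evaluated through `T = Re T + i Im T`. -/
def dixmierTrace (ω : DixmierLimit) (T : E →L[ℂ] E) : ℂ :=
  (dixmierTraceSA ω (ℜ T : E →L[ℂ] E) : ℂ) +
    Complex.I * (dixmierTraceSA ω (ℑ T : E →L[ℂ] E) : ℂ)

end Dixmier

/-! ### The harmonic oscillator -/

/-- The Hilbert space `L²(ℝ)` of complex functions. -/
abbrev L2 : Type := Lp ℂ 2 (volume : Measure ℝ)

/-- `-d²/dx² + x²` as an operator on the Schwartz space. -/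
def schwartzOscillator : 𝓢(ℝ, ℂ) →L[ℂ] 𝓢(ℝ, ℂ) :=
  -(SchwartzMap.derivCLM ℂ ℂ ∘L SchwartzMap.derivCLM ℂ ℂ) +
    SchwartzMap.smulLeftCLM ℂ (fun x : ℝ => ((x : ℂ) ^ 2))

theorem schwartzOscillator_apply (φ : 𝓢(ℝ, ℂ)) (x : ℝ) :
    schwartzOscillator φ x = -deriv (deriv φ) x + (x : ℂ) ^ 2 * φ x := by
  have h : (fun x : ℝ => ((x : ℂ) ^ 2)).HasTemperateGrowth := by fun_prop
  have h2 : ⇑(SchwartzMap.derivCLM ℂ ℂ φ) = deriv φ := by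
    ext y; simp
  simp [schwartzOscillator, SchwartzMap.smulLeftCLM_apply_apply h, h2]

/-- The inclusion of the Schwartz space in `L²(ℝ)`. -/
def schwartzToL2 : 𝓢(ℝ, ℂ) →ₗ[ℂ] L2 :=
  (SchwartzMap.toLpCLM ℂ ℂ 2 (volume : Measure ℝ)).toLinearMap

theorem schwartzToL2_injective : Function.Injective schwartzToL2 :=
  SchwartzMap.injective_toLp 2 (volume : Measure ℝ)

/-- The operator `-d²/dx² + x²` in `L²(ℝ)` with domain the Schwartz functions. -/
def oscillatorOnSchwartz : L2 →ₗ.[ℂ] L2 where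
  domain := LinearMap.range schwartzToL2
  toFun := schwartzToL2 ∘ₗ schwartzOscillator.toLinearMap ∘ₗ
    (LinearEquiv.ofInjective schwartzToL2 schwartzToL2_injective).symm.toLinearMap

/-- The harmonic oscillator `H`: the closure of `-d²/dx² + x²` on the Schwartz functions, which
is the self-adjoint extension of that operator. -/
def harmonicOscillator : L2 →ₗ.[ℂ] L2 :=
  oscillatorOnSchwartz.closure

/-- The bounded operator `R` is the inverse of the unbounded operator `A`: the graph of `A`
is the transposed graph of `R`, that is, `A` is a bijection of its domain onto the whole
space with inverse `R`. -/
def IsBoundedInverse (A : L2 →ₗ.[ℂ] L2) (R : L2 →L[ℂ] L2) : Prop :=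
  ∀ u v : L2, (u, v) ∈ A.graph ↔ R v = u

open Classical in
/-- The bounded inverse `H⁻¹` of the harmonic oscillator (it is unique; the value would be `0` if
there were none). -/
def oscillatorInv : L2 →L[ℂ] L2 :=
  if h : ∃ R : L2 →L[ℂ] L2, IsBoundedInverse harmonicOscillator R then h.choose else 0

/-! ### Multiplication operators and the asymptotic mean -/

theorem memLp_top (f : ℝ →ᵇ ℂ) : MemLp f ∞ (volume : Measure ℝ) :=
  memLp_top_of_bound f.continuous.aestronglyMeasurable ‖f‖
    (Eventually.of_forall f.norm_coe_le_norm)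

/-- The operator of multiplication by a bounded continuous function on `L²(ℝ)`. -/
def mulOp (f : ℝ →ᵇ ℂ) : L2 →L[ℂ] L2 :=
  (ContinuousLinearMap.mul ℂ ℂ).holderL volume ∞ 2 2 ((memLp_top f).toLp f)

theorem mulOp_apply_ae (f : ℝ →ᵇ ℂ) (g : L2) :
    mulOp f g =ᵐ[volume] fun x => f x * g x := by
  have h1 := (ContinuousLinearMap.mul ℂ ℂ).coeFn_holder (r := 2) ((memLp_top f).toLp f) g
  filter_upwards [h1, (memLp_top f).coeFn_toLp] with x hx hy
  rw [hy] at hx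
  exact hx

/-- `f` has the asymptotic mean property with asymptotic mean `m`: the limits `μ₊`, `μ₋` of
`(1/x) ∫₀ˣ f` as `x → ±∞` exist and `m` is their average. -/
def HasAsymptoticMean (f : ℝ → ℂ) (m : ℂ) : Prop :=
  ∃ μm μp : ℂ,
    Tendsto (fun x : ℝ => (1 / (x : ℂ)) * ∫ u in (0 : ℝ)..x, f u) atBot (𝓝 μm) ∧
    Tendsto (fun x : ℝ => (1 / (x : ℂ)) * ∫ u in (0 : ℝ)..x, f u) atTop (𝓝 μp) ∧
    m = (1 / 2) * μm + (1 / 2) * μp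

end HarmonicDixmier

end

/-!
Everything is read off from the Hermite basis `h_n`, in which `H⁻¹` is diagonal with entries
`1 / (2n + 1)`. Hence `T = f H⁻¹` has norm at most `‖f‖ / (n + 1)` on the orthogonal complement of
`h_0, …, h_{n-1}`, and for such an operator the sum of the first `n` singular values of a positive
part differs from a partial trace along the basis by a bounded amount. So the Dixmier trace of `T`
is the limit of the logarithmic means of its diagonal entries `⟪h_n, f h_n⟫ / (2n + 1)`.

The Abel sums `∑ r ^ n ⟪h_n, f h_n⟫` are given by Mehler's formula as Gaussian integrals of `f`
whose width grows as `r → 1`. Integrating by parts turns these into Gaussian averages of the means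
`(1 / x) ∫₀ˣ f`, so `(1 - r) ∑ r ^ n ⟪h_n, f h_n⟫` tends to the asymptotic mean of `f`. Only Abel
convergence is available here, and this is enough for logarithmic means: if the Abel means of a
bounded sequence `b` tend to `0`, then the primitive of `∑ r ^ n b_n` is `o(log (1 - r))`, and at
`r = 1 - 1 / (n + 2)` it agrees with `∑_{k ≤ n} b_k / (k + 1)` up to a bounded error.
-/

noncomputable section

namespace HarmonicDixmier

/-! ### Orthonormal expansions -/

section OrthonormalExpansions

variable {𝕜 E ι : Type*} [RCLike 𝕜] [NormedAddCommGroup E] [InnerProductSpace 𝕜 E]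

theorem norm_le_norm_of_norm_inner_le (b : HilbertBasis ι 𝕜 E) {x y : E}
    (h : ∀ i, ‖inner 𝕜 (b i) x‖ ≤ ‖inner 𝕜 (b i) y‖) : ‖x‖ ≤ ‖y‖ := by
  rw [← b.repr.norm_map x, ← b.repr.norm_map y]
  exact lp.norm_mono two_ne_zero fun i => by simpa only [b.repr_apply_apply] using h i

theorem ext_inner_hilbertBasis (b : HilbertBasis ι 𝕜 E) {x y : E}
    (h : ∀ i, inner 𝕜 (b i) x = inner 𝕜 (b i) y) : x = y :=
  b.repr.injective <| lp.ext <| funext fun i => by simpa only [b.repr_apply_apply] using h i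

variable {A : E →ₗ[𝕜] E} [FiniteDimensional 𝕜 E] {n : ℕ}

theorem inner_eigenvectorBasis_apply (hA : A.IsSymmetric) (hn : Module.finrank 𝕜 E = n)
    (i : Fin n) (x : E) :
    inner 𝕜 (hA.eigenvectorBasis hn i) (A x)
      = hA.eigenvalues hn i * inner 𝕜 (hA.eigenvectorBasis hn i) x := by
  simpa only [OrthonormalBasis.repr_apply_apply] using
    hA.eigenvectorBasis_apply_self_apply hn x i

theorem eigenvalues_mul_norm_le_norm_apply (hA : A.IsPositive) (hn : Module.finrank 𝕜 E = n)
    {i : Fin n} {x : E}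
    (hx : ∀ j, i < j → inner 𝕜 (hA.isSymmetric.eigenvectorBasis hn j) x = 0) :
    hA.isSymmetric.eigenvalues hn i * ‖x‖ ≤ ‖A x‖ := by
  have : CompleteSpace E := FiniteDimensional.complete 𝕜 E
  have hnonneg := hA.nonneg_eigenvalues hn
  rw [← RCLike.norm_of_nonneg (K := 𝕜) (hnonneg i), ← norm_smul]
  refine norm_le_norm_of_norm_inner_le
    (hA.isSymmetric.eigenvectorBasis hn).toHilbertBasis fun j => ?_
  rw [OrthonormalBasis.coe_toHilbertBasis, inner_eigenvectorBasis_apply, inner_smul_right]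
  obtain hij | hji := lt_or_ge i j
  · simp [hx j hij]
  · simp only [norm_mul, RCLike.norm_ofReal, abs_of_nonneg, hnonneg]
    gcongr
    exact hA.isSymmetric.eigenvalues_antitone hn hji

theorem norm_apply_le_eigenvalues_mul_norm (hA : A.IsPositive) (hn : Module.finrank 𝕜 E = n)
    {i : Fin n} {x : E}
    (hx : ∀ j, j < i → inner 𝕜 (hA.isSymmetric.eigenvectorBasis hn j) x = 0) :
    ‖A x‖ ≤ hA.isSymmetric.eigenvalues hn i * ‖x‖ := by
  have : CompleteSpace E := FiniteDimensional.complete 𝕜 E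
  have hnonneg := hA.nonneg_eigenvalues hn
  rw [← RCLike.norm_of_nonneg (K := 𝕜) (hnonneg i), ← norm_smul]
  refine norm_le_norm_of_norm_inner_le
    (hA.isSymmetric.eigenvectorBasis hn).toHilbertBasis fun j => ?_
  rw [OrthonormalBasis.coe_toHilbertBasis, inner_eigenvectorBasis_apply, inner_smul_right]
  obtain hji | hij := lt_or_ge j i
  · simp [hx j hji]
  · simp only [norm_mul, RCLike.norm_ofReal, abs_of_nonneg, hnonneg]
    gcongr
    exact hA.isSymmetric.eigenvalues_antitone hn hij

end OrthonormalExpansions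

/-! ### Singular values -/

section SingularValues

variable {E : Type*} [NormedAddCommGroup E] [InnerProductSpace ℂ E]

theorem singularValue_le_norm_sub (T F : E →L[ℂ] E) {k : ℕ}
    (hF : (F : E →ₗ[ℂ] E).rank ≤ (k : Cardinal)) : singularValue T k ≤ ‖T - F‖ :=
  csInf_le ⟨0, by rintro _ ⟨F, -, rfl⟩; exact norm_nonneg _⟩ ⟨F, hF, rfl⟩

theorem le_singularValue (T : E →L[ℂ] E) {k : ℕ} {r : ℝ}
    (h : ∀ F : E →L[ℂ] E, (F : E →ₗ[ℂ] E).rank ≤ (k : Cardinal) → r ≤ ‖T - F‖) :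
    r ≤ singularValue T k :=
  le_csInf ⟨‖T - 0‖, 0, by simp, rfl⟩ (by rintro _ ⟨F, hF, rfl⟩; exact h F hF)

theorem singularValue_nonneg (T : E →L[ℂ] E) (k : ℕ) : 0 ≤ singularValue T k :=
  le_singularValue T fun _ _ => norm_nonneg _

theorem singularValue_antitone (T : E →L[ℂ] E) : Antitone (singularValue T) := fun j k hjk =>
  le_singularValue T fun F hF =>
    singularValue_le_norm_sub T F (hF.trans (by exact_mod_cast hjk))

theorem exists_rank_le_norm_sub_lt (T : E →L[ℂ] E) (k : ℕ) {r : ℝ} (h : singularValue T k < r) :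
    ∃ F : E →L[ℂ] E, (F : E →ₗ[ℂ] E).rank ≤ (k : Cardinal) ∧ ‖T - F‖ < r := by
  by_contra! hcon
  exact h.not_ge (le_singularValue T hcon)

theorem singularValue_le_add_norm_sub (T S : E →L[ℂ] E) (k : ℕ) :
    singularValue T k ≤ singularValue S k + ‖T - S‖ := by
  rw [← sub_le_iff_le_add]
  refine le_singularValue S fun F hF => sub_le_iff_le_add.2 ?_
  calc singularValue T k ≤ ‖T - F‖ := singularValue_le_norm_sub T F hF
    _ ≤ ‖T - S‖ + ‖S - F‖ := norm_sub_le_norm_sub_add_norm_sub T S F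
    _ = ‖S - F‖ + ‖T - S‖ := add_comm _ _

theorem singularValue_add_le (S T : E →L[ℂ] E) (j k : ℕ) :
    singularValue (S + T) (j + k) ≤ singularValue S j + singularValue T k := by
  refine le_of_forall_pos_le_add fun ε hε => ?_
  obtain ⟨F, hF, hSF⟩ := exists_rank_le_norm_sub_lt S j (lt_add_of_pos_right _ (half_pos hε))
  obtain ⟨G, hG, hTG⟩ := exists_rank_le_norm_sub_lt T k (lt_add_of_pos_right _ (half_pos hε))
  have hrank : ((F + G : E →L[ℂ] E) : E →ₗ[ℂ] E).rank ≤ ((j + k : ℕ) : Cardinal) := by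
    push_cast
    exact (LinearMap.rank_add_le _ _).trans (add_le_add hF hG)
  calc singularValue (S + T) (j + k) ≤ ‖S + T - (F + G)‖ := singularValue_le_norm_sub _ _ hrank
    _ = ‖(S - F) + (T - G)‖ := by rw [add_sub_add_comm]
    _ ≤ ‖S - F‖ + ‖T - G‖ := norm_add_le _ _
    _ ≤ singularValue S j + singularValue T k + ε := by linarith

theorem singularValue_smul_le (c : ℂ) (T : E →L[ℂ] E) (k : ℕ) :
    singularValue (c • T) k ≤ ‖c‖ * singularValue T k := by
  obtain rfl | hc := eq_or_ne c 0
  · simpa using singularValue_le_norm_sub (0 : E →L[ℂ] E) 0 (k := k) (by simp)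
  rw [← div_le_iff₀' (norm_pos_iff.2 hc)]
  refine le_singularValue T fun F hF => ?_
  rw [div_le_iff₀' (norm_pos_iff.2 hc), ← norm_smul, smul_sub]
  refine singularValue_le_norm_sub _ _ (le_trans ?_ hF)
  exact LinearMap.rank_comp_le_right (F : E →ₗ[ℂ] E) (c • LinearMap.id)

theorem finiteDimensional_range_of_rank_le {F : E →L[ℂ] E} {k : ℕ}
    (hF : (F : E →ₗ[ℂ] E).rank ≤ (k : Cardinal)) :
    FiniteDimensional ℂ (LinearMap.range (F : E →ₗ[ℂ] E)) :=
  Module.rank_lt_aleph0_iff.1 (hF.trans_lt Cardinal.natCast_lt_aleph0)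

theorem rank_comp_starProjection_le (T : E →L[ℂ] E) (V : Submodule ℂ E) [FiniteDimensional ℂ V] :
    ((T ∘L V.starProjection : E →L[ℂ] E) : E →ₗ[ℂ] E).rank
      ≤ (Module.finrank ℂ V : Cardinal) := by
  have hfactor : ((T ∘L V.starProjection : E →L[ℂ] E) : E →ₗ[ℂ] E)
      = ((T : E →ₗ[ℂ] E) ∘ₗ V.subtype) ∘ₗ (V.orthogonalProjectionOnto : E →ₗ[ℂ] V) := rfl
  rw [hfactor, Module.finrank_eq_rank]
  exact (LinearMap.rank_comp_le_left _ _).trans (LinearMap.rank_le_domain _)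

theorem singularValue_le_of_orthogonal (T : E →L[ℂ] E) (V : Submodule ℂ E)
    [FiniteDimensional ℂ V] {k : ℕ} (hV : Module.finrank ℂ V ≤ k) {r : ℝ} (hr : 0 ≤ r)
    (h : ∀ x ∈ Vᗮ, ‖T x‖ ≤ r * ‖x‖) : singularValue T k ≤ r := by
  refine (singularValue_le_norm_sub T (T ∘L V.starProjection)
    ((rank_comp_starProjection_le T V).trans (by exact_mod_cast hV))).trans ?_
  refine ContinuousLinearMap.opNorm_le_bound _ hr fun x => ?_
  have hsub : (T - T ∘L V.starProjection) x = T (Vᗮ.starProjection x) := by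
    simp [Submodule.starProjection_orthogonal]
  calc ‖(T - T ∘L V.starProjection) x‖ ≤ r * ‖Vᗮ.starProjection x‖ :=
        hsub ▸ h _ (Submodule.starProjection_apply_mem _ _)
    _ ≤ r * ‖x‖ := by gcongr; exact Submodule.norm_starProjection_apply_le _ _

theorem singularValue_comp_comp_le {E' : Type*} [NormedAddCommGroup E'] [InnerProductSpace ℂ E']
    {A : E →L[ℂ] E'} {B : E' →L[ℂ] E} (hA : ‖A‖ ≤ 1) (hB : ‖B‖ ≤ 1) (T : E →L[ℂ] E) (k : ℕ) :
    singularValue (A ∘L T ∘L B) k ≤ singularValue T k := by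
  refine le_singularValue T fun F hF => ?_
  have hrank : ((A ∘L F ∘L B : E' →L[ℂ] E') : E' →ₗ[ℂ] E').rank ≤ (k : Cardinal) := by
    refine Cardinal.lift_le_nat_iff.1 <| (LinearMap.lift_rank_comp_le_right
      (F.toLinearMap ∘ₗ B.toLinearMap) A.toLinearMap).trans <| Cardinal.lift_le_nat_iff.2 ?_
    exact (LinearMap.rank_comp_le_left B.toLinearMap F.toLinearMap).trans hF
  calc singularValue (A ∘L T ∘L B) k ≤ ‖A ∘L T ∘L B - A ∘L F ∘L B‖ :=
        singularValue_le_norm_sub _ _ hrank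
    _ = ‖A ∘L (T - F) ∘L B‖ := by
        rw [← ContinuousLinearMap.comp_sub, ← ContinuousLinearMap.sub_comp]
    _ ≤ ‖A‖ * (‖T - F‖ * ‖B‖) := (ContinuousLinearMap.opNorm_comp_le _ _).trans
        (by gcongr; exact ContinuousLinearMap.opNorm_comp_le _ _)
    _ ≤ 1 * (‖T - F‖ * 1) := by gcongr
    _ = ‖T - F‖ := by rw [one_mul, mul_one]

theorem singularValue_eq_eigenvalues [FiniteDimensional ℂ E] {A : E →L[ℂ] E} (hA : A.IsPositive)
    {n : ℕ} (hn : Module.finrank ℂ E = n) (i : Fin n) :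
    singularValue A i = hA.toLinearMap.isSymmetric.eigenvalues hn i := by
  set b := hA.toLinearMap.isSymmetric.eigenvectorBasis hn
  refine le_antisymm ?_ (le_singularValue A fun F hF => ?_)
  · have hdim : Module.finrank ℂ (Submodule.span ℂ (Set.range fun j : Finset.Iio i => b j)) ≤ i :=
      (finrank_range_le_card _).trans (by rw [Fintype.card_coe, Fin.card_Iio])
    refine singularValue_le_of_orthogonal A _ hdim (hA.toLinearMap.nonneg_eigenvalues hn i)
      fun x hx => norm_apply_le_eigenvalues_mul_norm hA.toLinearMap hn fun j hj => ?_
    exact hx _ (Submodule.subset_span ⟨⟨j, Finset.mem_Iio.2 hj⟩, rfl⟩)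
  · obtain ⟨x, hx, hx0⟩ := Submodule.exists_mem_ne_zero_of_ne_bot <|
      LinearMap.ker_ne_bot_of_finrank_lt (f := F.toLinearMap.rangeRestrict.prod
        (LinearMap.pi fun j : Finset.Ioi i => (innerSL ℂ (b j)).toLinearMap)) <| by
          have hrange := Module.finrank_le_of_rank_le hF
          rw [Module.finrank_prod, Module.finrank_fintype_fun_eq_card, Fintype.card_coe,
            Fin.card_Ioi, hn]
          omega
    rw [LinearMap.mem_ker, LinearMap.prod_apply, Function.prod_apply, Prod.mk_eq_zero] at hx
    have hFx : F x = 0 := congrArg Subtype.val hx.1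
    have hbx (j : Fin n) (hj : i < j) : inner ℂ (b j) x = 0 :=
      congrFun hx.2 ⟨j, Finset.mem_Ioi.2 hj⟩
    refine le_of_mul_le_mul_right ?_ (norm_pos_iff.2 hx0)
    calc _ ≤ ‖A x‖ := eigenvalues_mul_norm_le_norm_apply hA.toLinearMap hn hbx
      _ = ‖(A - F) x‖ := by simp [hFx]
      _ ≤ ‖A - F‖ * ‖x‖ := (A - F).le_opNorm x

theorem sum_range_singularValue_eq_re_trace [FiniteDimensional ℂ E] {A : E →L[ℂ] E}
    (hA : A.IsPositive) :
    ∑ k ∈ Finset.range (Module.finrank ℂ E), singularValue A k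
      = (LinearMap.trace ℂ E (A : E →ₗ[ℂ] E)).re := by
  rw [← Fin.sum_univ_eq_sum_range]
  simp only [singularValue_eq_eigenvalues hA rfl]
  exact (hA.toLinearMap.isSymmetric.re_trace_eq_sum_eigenvalues rfl).symm

theorem singularValue_eq_zero_of_finrank_le [FiniteDimensional ℂ E] (A : E →L[ℂ] E) {k : ℕ}
    (hk : Module.finrank ℂ E ≤ k) : singularValue A k = 0 := by
  refine le_antisymm ?_ (singularValue_nonneg A k)
  have hrank : (A : E →ₗ[ℂ] E).rank ≤ (k : Cardinal) :=
    (LinearMap.rank_le_domain _).trans (by rw [← Module.finrank_eq_rank]; exact_mod_cast hk)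
  simpa using singularValue_le_norm_sub A A hrank

variable [CompleteSpace E]

theorem rank_adjoint_le {F : E →L[ℂ] E} {k : ℕ} (hF : (F : E →ₗ[ℂ] E).rank ≤ (k : Cardinal)) :
    ((ContinuousLinearMap.adjoint F : E →L[ℂ] E) : E →ₗ[ℂ] E).rank ≤ (k : Cardinal) := by
  have : FiniteDimensional ℂ (LinearMap.range (F : E →ₗ[ℂ] E)) :=
    finiteDimensional_range_of_rank_le hF
  set P := (LinearMap.range (F : E →ₗ[ℂ] E)).starProjection
  have hPF : P ∘L F = F :=
    ContinuousLinearMap.ext fun x => Submodule.starProjection_eq_self_iff.2 ⟨x, rfl⟩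
  have hadj : ContinuousLinearMap.adjoint F = ContinuousLinearMap.adjoint F ∘L P := by
    conv_lhs => rw [← hPF, ContinuousLinearMap.adjoint_comp]
    rw [(isSelfAdjoint_starProjection _).adjoint_eq]
  rw [hadj]
  exact (rank_comp_starProjection_le _ _).trans (by rw [Module.finrank_eq_rank]; exact hF)

theorem singularValue_adjoint (T : E →L[ℂ] E) (k : ℕ) :
    singularValue (ContinuousLinearMap.adjoint T) k = singularValue T k := by
  have hle (S : E →L[ℂ] E) : singularValue (ContinuousLinearMap.adjoint S) k ≤ singularValue S k :=
    le_singularValue S fun F hF => by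
      rw [← ContinuousLinearMap.adjoint.norm_map, map_sub]
      exact singularValue_le_norm_sub _ _ (rank_adjoint_le hF)
  exact (hle T).antisymm (by simpa using hle (ContinuousLinearMap.adjoint T))

theorem singularValue_le_of_norm_apply_le {T S : E →L[ℂ] E} (h : ∀ x, ‖T x‖ ≤ ‖S x‖) (k : ℕ) :
    singularValue T k ≤ singularValue S k := by
  refine le_singularValue S fun F hF => ?_
  set F' := ContinuousLinearMap.adjoint F
  have : FiniteDimensional ℂ (LinearMap.range (F' : E →ₗ[ℂ] E)) :=
    finiteDimensional_range_of_rank_le (rank_adjoint_le hF)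
  refine singularValue_le_of_orthogonal T (LinearMap.range (F' : E →ₗ[ℂ] E))
    (Module.finrank_le_of_rank_le (rank_adjoint_le hF)) (norm_nonneg _) fun x hx => ?_
  have hFx : F x = 0 := by
    rw [ContinuousLinearMap.orthogonal_range, ContinuousLinearMap.adjoint_adjoint] at hx
    exact hx
  calc ‖T x‖ ≤ ‖S x‖ := h x
    _ = ‖(S - F) x‖ := by simp [hFx]
    _ ≤ ‖S - F‖ * ‖x‖ := (S - F).le_opNorm x

theorem singularValue_realPart_le (T : E →L[ℂ] E) (k : ℕ) :
    singularValue (ℜ T : E →L[ℂ] E) (k + k) ≤ singularValue T k := by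
  calc singularValue (ℜ T : E →L[ℂ] E) (k + k)
      = singularValue (((2⁻¹ : ℝ) : ℂ) • (T + ContinuousLinearMap.adjoint T)) (k + k) := by
        rw [realPart_apply_coe, ← Complex.coe_smul, ContinuousLinearMap.star_eq_adjoint]
    _ ≤ 2⁻¹ * singularValue (T + ContinuousLinearMap.adjoint T) (k + k) := by
        simpa using singularValue_smul_le ((2⁻¹ : ℝ) : ℂ)
          (T + ContinuousLinearMap.adjoint T) (k + k)
    _ ≤ 2⁻¹ * (singularValue T k + singularValue (ContinuousLinearMap.adjoint T) k) := by
        gcongr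
        exact singularValue_add_le _ _ _ _
    _ = singularValue T k := by rw [singularValue_adjoint]; ring

end SingularValues

/-! ### Traces over finite-dimensional subspaces -/

section Traces

variable {E : Type*} [NormedAddCommGroup E] [InnerProductSpace ℂ E]

/-- The compression `P_W T|_W` of a bounded operator to a finite-dimensional subspace `W`. -/
def compression (W : Submodule ℂ E) [FiniteDimensional ℂ W] (T : E →L[ℂ] E) : W →L[ℂ] W :=
  W.orthogonalProjectionOnto ∘L T ∘L W.subtypeL

/-- The real part of the trace of the compression of `T` to `W`. Unlike the trace of `T` it exists
for every bounded operator. -/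
def traceOn (W : Submodule ℂ E) [FiniteDimensional ℂ W] (T : E →L[ℂ] E) : ℝ :=
  (LinearMap.trace ℂ W (compression W T : W →ₗ[ℂ] W)).re

theorem traceOn_sub (W : Submodule ℂ E) [FiniteDimensional ℂ W] (T S : E →L[ℂ] E) :
    traceOn W (T - S) = traceOn W T - traceOn W S := by
  simp only [traceOn, compression, ContinuousLinearMap.sub_comp, ContinuousLinearMap.comp_sub,
    ContinuousLinearMap.toLinearMap_sub, map_sub, Complex.sub_re]

theorem traceOn_eq_sum {ι : Type*} [Fintype ι] {W : Submodule ℂ E} [FiniteDimensional ℂ W]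
    (T : E →L[ℂ] E) {e : ι → E} (he : Orthonormal ℂ e) (hW : Submodule.span ℂ (Set.range e) = W) :
    traceOn W T = ∑ i, (inner ℂ (e i) (T (e i))).re := by
  have hmem (i : ι) : e i ∈ W := hW ▸ Submodule.subset_span ⟨i, rfl⟩
  have hspan : ⊤ ≤ Submodule.span ℂ (Set.range (Set.codRestrict e W hmem)) := by
    rw [← Submodule.map_le_map_iff_of_injective W.injective_subtype, Submodule.map_span,
      ← Set.range_comp, Submodule.map_top, Submodule.range_subtype]
    exact hW.ge
  let b := OrthonormalBasis.mk (he.codRestrict W hmem) hspan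
  rw [traceOn, LinearMap.trace_eq_sum_inner _ b, Complex.re_sum]
  simp [b, compression]

theorem exists_orthonormal_span_eq (W : Submodule ℂ E) [FiniteDimensional ℂ W] :
    ∃ e : Fin (Module.finrank ℂ W) → E, Orthonormal ℂ e ∧ Submodule.span ℂ (Set.range e) = W := by
  let b := stdOrthonormalBasis ℂ W
  refine ⟨fun i => (b i : E), b.orthonormal.comp_linearIsometry W.subtypeₗᵢ, ?_⟩
  have hspan := congrArg (Submodule.map W.subtype) b.toBasis.span_eq
  rw [Submodule.map_span, ← Set.range_comp] at hspan
  simpa [Function.comp_def] using hspan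

theorem abs_traceOn_le (W : Submodule ℂ E) [FiniteDimensional ℂ W] (T : E →L[ℂ] E) {c : ℝ}
    (h : ∀ v ∈ W, |(inner ℂ v (T v)).re| ≤ c * ‖v‖ ^ 2) :
    |traceOn W T| ≤ Module.finrank ℂ W * c := by
  obtain ⟨e, he, hW⟩ := exists_orthonormal_span_eq W
  rw [traceOn_eq_sum T he hW]
  refine (Finset.abs_sum_le_sum_abs _ _).trans ?_
  refine (Finset.sum_le_card_nsmul _ _ c fun i _ => ?_).trans (by simp)
  simpa [he.1 i] using h (e i) (hW ▸ Submodule.subset_span ⟨i, rfl⟩)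

theorem traceOn_eq_add {U V W : Submodule ℂ E} [FiniteDimensional ℂ U] [FiniteDimensional ℂ V]
    [FiniteDimensional ℂ W] (hUV : U ⟂ V) (hW : U ⊔ V = W) (T : E →L[ℂ] E) :
    traceOn W T = traceOn U T + traceOn V T := by
  obtain ⟨e, he, hU⟩ := exists_orthonormal_span_eq U
  obtain ⟨e', he', hV⟩ := exists_orthonormal_span_eq V
  have horth (i j) : inner ℂ (e i) (e' j) = 0 :=
    hUV.inner_eq (hU ▸ Submodule.subset_span ⟨i, rfl⟩) (hV ▸ Submodule.subset_span ⟨j, rfl⟩)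
  have hsum : Orthonormal ℂ (Sum.elim e e') := by
    refine ⟨by rintro (i | i) <;> simp [he.1, he'.1], ?_⟩
    rintro (i | i) (j | j) hij
    · exact he.2 fun h => hij (by rw [h])
    · exact horth i j
    · exact inner_eq_zero_symm.1 (horth j i)
    · exact he'.2 fun h => hij (by rw [h])
  rw [traceOn_eq_sum T he hU, traceOn_eq_sum T he' hV, traceOn_eq_sum T hsum
    (by rw [Set.Sum.elim_range, Submodule.span_union, hU, hV, hW]), Fintype.sum_sum_type]
  simp only [Sum.elim_inl, Sum.elim_inr]

theorem abs_traceOn_sub_traceOn_le {U W : Submodule ℂ E} [FiniteDimensional ℂ U]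
    [FiniteDimensional ℂ W] (hUW : U ≤ W) (T : E →L[ℂ] E) {c : ℝ} (hc : 0 ≤ c) {d : ℕ}
    (hd : Module.finrank ℂ W ≤ Module.finrank ℂ U + d)
    (h : ∀ v ∈ Uᗮ, |(inner ℂ v (T v)).re| ≤ c * ‖v‖ ^ 2) :
    |traceOn W T - traceOn U T| ≤ d * c := by
  have : FiniteDimensional ℂ (Uᗮ ⊓ W : Submodule ℂ E) :=
    Submodule.finiteDimensional_of_le inf_le_right
  have hdim : Module.finrank ℂ (Uᗮ ⊓ W : Submodule ℂ E) ≤ d := by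
    have := Submodule.finrank_add_inf_finrank_orthogonal hUW
    omega
  rw [traceOn_eq_add ((Submodule.isOrtho_orthogonal_right U).mono_right inf_le_left)
    (Submodule.sup_orthogonal_inf_of_hasOrthogonalProjection hUW) T, add_sub_cancel_left]
  calc |traceOn (Uᗮ ⊓ W) T| ≤ Module.finrank ℂ (Uᗮ ⊓ W : Submodule ℂ E) * c :=
        abs_traceOn_le _ T fun v hv => h v hv.1
    _ ≤ d * c := by gcongr

theorem norm_sub_starProjection_comp_le {T F : E →L[ℂ] E} (W : Submodule ℂ E)
    [FiniteDimensional ℂ W] (hF : ∀ x, F x ∈ W) :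
    ‖T - W.starProjection ∘L T‖ ≤ ‖T - F‖ := by
  have hfactor : T - W.starProjection ∘L T = Wᗮ.starProjection ∘L (T - F) := by
    ext x
    simp [Submodule.starProjection_orthogonal, Submodule.starProjection_eq_self_iff.2 (hF x)]
  calc ‖T - W.starProjection ∘L T‖ ≤ ‖Wᗮ.starProjection‖ * ‖T - F‖ :=
        hfactor ▸ ContinuousLinearMap.opNorm_comp_le _ _
    _ ≤ ‖T - F‖ := mul_le_of_le_one_left (norm_nonneg _) (Submodule.starProjection_norm_le _)

variable [CompleteSpace E]

theorem isPositive_compression (W : Submodule ℂ E) [FiniteDimensional ℂ W] {T : E →L[ℂ] E}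
    (hT : T.IsPositive) : (compression W T).IsPositive := by
  simpa only [compression, Submodule.adjoint_subtypeL] using hT.adjoint_conj W.subtypeL

theorem traceOn_le_sum_singularValue (W : Submodule ℂ E) [FiniteDimensional ℂ W]
    {T : E →L[ℂ] E} (hT : T.IsPositive) {n : ℕ} (hn : Module.finrank ℂ W ≤ n) :
    traceOn W T ≤ ∑ k ∈ Finset.range n, singularValue T k := by
  rw [traceOn, ← sum_range_singularValue_eq_re_trace (isPositive_compression W hT)]
  calc ∑ k ∈ Finset.range (Module.finrank ℂ W), singularValue (compression W T) k
      ≤ ∑ k ∈ Finset.range (Module.finrank ℂ W), singularValue T k :=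
        Finset.sum_le_sum fun k _ => singularValue_comp_comp_le
          W.orthogonalProjectionOnto_norm_le W.norm_subtypeL_le T k
    _ ≤ ∑ k ∈ Finset.range n, singularValue T k :=
        Finset.sum_le_sum_of_subset_of_nonneg (Finset.range_mono hn)
          fun k _ _ => singularValue_nonneg T k

theorem sum_singularValue_compression_le_traceOn (W : Submodule ℂ E) [FiniteDimensional ℂ W]
    {T : E →L[ℂ] E} (hT : T.IsPositive) (n : ℕ) :
    ∑ k ∈ Finset.range n, singularValue (compression W T) k ≤ traceOn W T := by
  rw [traceOn, ← sum_range_singularValue_eq_re_trace (isPositive_compression W hT)]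
  calc ∑ k ∈ Finset.range n, singularValue (compression W T) k
      = ∑ k ∈ Finset.range n with k < Module.finrank ℂ W, singularValue (compression W T) k := by
        refine (Finset.sum_filter_of_ne fun k _ hk => ?_).symm
        by_contra! hle
        exact hk (singularValue_eq_zero_of_finrank_le _ hle)
    _ ≤ ∑ k ∈ Finset.range (Module.finrank ℂ W), singularValue (compression W T) k :=
        Finset.sum_le_sum_of_subset_of_nonneg (fun k hk => by simp_all)
          fun k _ _ => singularValue_nonneg _ k

theorem sum_singularValue_le_traceOn_add (W : Submodule ℂ E) [FiniteDimensional ℂ W]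
    {T : E →L[ℂ] E} (hT : T.IsPositive) (n : ℕ) :
    ∑ k ∈ Finset.range n, singularValue T k
      ≤ traceOn W T + n * ‖T - W.starProjection ∘L T ∘L W.starProjection‖ := by
  set K := W.starProjection ∘L T ∘L W.starProjection
  have hK (k : ℕ) : singularValue K k ≤ singularValue (compression W T) k :=
    singularValue_comp_comp_le (A := W.subtypeL) (B := W.orthogonalProjectionOnto)
      W.norm_subtypeL_le W.orthogonalProjectionOnto_norm_le (compression W T) k
  calc ∑ k ∈ Finset.range n, singularValue T k
      ≤ ∑ k ∈ Finset.range n, (singularValue (compression W T) k + ‖T - K‖) :=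
        Finset.sum_le_sum fun k _ => (singularValue_le_add_norm_sub T K k).trans (by grw [hK k])
    _ = ∑ k ∈ Finset.range n, singularValue (compression W T) k + n * ‖T - K‖ := by
        rw [Finset.sum_add_distrib, Finset.sum_const, Finset.card_range, nsmul_eq_mul]
    _ ≤ traceOn W T + n * ‖T - K‖ := by
        gcongr
        exact sum_singularValue_compression_le_traceOn W hT n

theorem norm_sub_starProjection_comp_comp_le {T F : E →L[ℂ] E} (hT : IsSelfAdjoint T)
    (W : Submodule ℂ E) [FiniteDimensional ℂ W] (hF : ∀ x, F x ∈ W) :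
    ‖T - W.starProjection ∘L T ∘L W.starProjection‖ ≤ 2 * ‖T - F‖ := by
  set P := W.starProjection
  have hleft : ‖T - P ∘L T‖ ≤ ‖T - F‖ := norm_sub_starProjection_comp_le W hF
  have hright : ‖T - T ∘L P‖ ≤ ‖T - F‖ := by
    have hadj : T - T ∘L P = ContinuousLinearMap.adjoint (T - P ∘L T) := by
      rw [map_sub, ContinuousLinearMap.adjoint_comp, hT.adjoint_eq,
        (isSelfAdjoint_starProjection W).adjoint_eq]
    rwa [hadj, ContinuousLinearMap.adjoint.norm_map]
  calc ‖T - P ∘L T ∘L P‖ = ‖(T - P ∘L T) + P ∘L (T - T ∘L P)‖ := by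
        rw [ContinuousLinearMap.comp_sub, sub_add_sub_cancel]
    _ ≤ ‖T - P ∘L T‖ + ‖P‖ * ‖T - T ∘L P‖ :=
        (norm_add_le _ _).trans (by gcongr; exact ContinuousLinearMap.opNorm_comp_le _ _)
    _ ≤ ‖T - F‖ + 1 * ‖T - F‖ := by
        gcongr
        exact Submodule.starProjection_norm_le _
    _ = 2 * ‖T - F‖ := by ring

end Traces

/-! ### Comparison of singular values with diagonal sums -/

section Comparison

variable {E : Type*} [NormedAddCommGroup E] [InnerProductSpace ℂ E]

theorem sum_singularValue_three_mul_le {T : E →L[ℂ] E} {C : ℝ}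
    (hC : ∀ k : ℕ, singularValue T k ≤ C / (k + 1)) {n : ℕ} (hn : 0 < n) :
    ∑ k ∈ Finset.range (n + 2 * n), singularValue T k
      ≤ ∑ k ∈ Finset.range n, singularValue T k + 2 * C := by
  have hC0 : 0 ≤ C := by simpa using (singularValue_nonneg T 0).trans (hC 0)
  have : (0 : ℝ) < n := by exact_mod_cast hn
  rw [Finset.sum_range_add]
  gcongr
  calc ∑ k ∈ Finset.range (2 * n), singularValue T (n + k)
      ≤ ∑ _k ∈ Finset.range (2 * n), C / n := by
        refine Finset.sum_le_sum fun k _ => (hC _).trans ?_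
        gcongr
        push_cast
        linarith [k.cast_nonneg (α := ℝ)]
    _ = 2 * C := by
        rw [Finset.sum_const, Finset.card_range, nsmul_eq_mul]
        push_cast
        field_simp

theorem exists_rank_le_norm_sub_le_div {T : E →L[ℂ] E} {C : ℝ}
    (hC : ∀ k : ℕ, singularValue T k ≤ C / (k + 1)) {n : ℕ} (hn : 0 < n) :
    ∃ F : E →L[ℂ] E, (F : E →ₗ[ℂ] E).rank ≤ (n : Cardinal) ∧ ‖T - F‖ ≤ (C + 1) / n := by
  have hn' : (0 : ℝ) < n := by exact_mod_cast hn
  have hC0 : 0 ≤ C := by simpa using (singularValue_nonneg T 0).trans (hC 0)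
  have hlt : singularValue T n < (C + 1) / n := by
    refine (hC n).trans_lt ?_
    rw [div_lt_div_iff₀ (by positivity) hn']
    nlinarith
  obtain ⟨F, hF, hTF⟩ := exists_rank_le_norm_sub_lt T n hlt
  exact ⟨F, hF, hTF.le⟩

theorem finrank_sup_range_sup_range_le (V : Submodule ℂ E) [FiniteDimensional ℂ V]
    {F₁ F₂ : E →L[ℂ] E} {n : ℕ} (h₁ : (F₁ : E →ₗ[ℂ] E).rank ≤ (n : Cardinal))
    (h₂ : (F₂ : E →ₗ[ℂ] E).rank ≤ (n : Cardinal)) :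
    Module.finrank ℂ (V ⊔ (LinearMap.range (F₁ : E →ₗ[ℂ] E) ⊔ LinearMap.range (F₂ : E →ₗ[ℂ] E)) :
      Submodule ℂ E) ≤ Module.finrank ℂ V + 2 * n := by
  set R₁ := LinearMap.range (F₁ : E →ₗ[ℂ] E)
  set R₂ := LinearMap.range (F₂ : E →ₗ[ℂ] E)
  have hR₁ : Module.finrank ℂ R₁ ≤ n := Module.finrank_le_of_rank_le h₁
  have hR₂ : Module.finrank ℂ R₂ ≤ n := Module.finrank_le_of_rank_le h₂
  have := finiteDimensional_range_of_rank_le h₁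
  have := finiteDimensional_range_of_rank_le h₂
  have hR := Submodule.finrank_add_le_finrank_add_finrank R₁ R₂
  have hW := Submodule.finrank_add_le_finrank_add_finrank V (R₁ ⊔ R₂)
  omega

variable [CompleteSpace E]

theorem abs_sum_singularValue_sub_traceOn_le {T F : E →L[ℂ] E} (hT : T.IsPositive) {C : ℝ}
    (hC : ∀ k : ℕ, singularValue T k ≤ C / (k + 1)) {n : ℕ} (hn : 0 < n) (W : Submodule ℂ E)
    [FiniteDimensional ℂ W] (hdim : Module.finrank ℂ W ≤ n + 2 * n) (hF : ∀ x, F x ∈ W)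
    (hTF : ‖T - F‖ ≤ (C + 1) / n) :
    |∑ k ∈ Finset.range n, singularValue T k - traceOn W T| ≤ 2 * (C + 1) := by
  have : (0 : ℝ) < n := by exact_mod_cast hn
  have hlower := (traceOn_le_sum_singularValue W hT hdim).trans
    (sum_singularValue_three_mul_le hC hn)
  have hupper := sum_singularValue_le_traceOn_add W hT n
  have herror : n * ‖T - W.starProjection ∘L T ∘L W.starProjection‖ ≤ 2 * (C + 1) :=
    calc n * ‖T - W.starProjection ∘L T ∘L W.starProjection‖
        ≤ n * (2 * ((C + 1) / n)) := by
          gcongr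
          exact (norm_sub_starProjection_comp_comp_le hT.isSelfAdjoint W hF).trans (by gcongr)
      _ = 2 * (C + 1) := by field_simp
  rw [abs_le]
  constructor <;> linarith

/-- The two partial sums of singular values and the diagonal sum are all compared with traces over
one subspace `W`, which contains `e 0, …, e (n - 1)` and the ranges of nearly optimal approximations
of rank `n` to `T₁` and `T₂`. -/
theorem abs_sum_singularValue_sub_diagonal_le {T₁ T₂ : E →L[ℂ] E} (h₁ : T₁.IsPositive)
    (h₂ : T₂.IsPositive) {C : ℝ} (hC₁ : ∀ k : ℕ, singularValue T₁ k ≤ C / (k + 1))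
    (hC₂ : ∀ k : ℕ, singularValue T₂ k ≤ C / (k + 1)) {e : ℕ → E} (he : Orthonormal ℂ e)
    {n : ℕ} (hn : 0 < n) (hdiag : ∀ v : E, (∀ k < n, inner ℂ (e k) v = 0) →
      |(inner ℂ v ((T₁ - T₂) v)).re| ≤ C / n * ‖v‖ ^ 2) :
    |(∑ k ∈ Finset.range n, singularValue T₁ k - ∑ k ∈ Finset.range n, singularValue T₂ k)
      - ∑ k ∈ Finset.range n, (inner ℂ (e k) ((T₁ - T₂) (e k))).re| ≤ 6 * (C + 1) := by
  have : (0 : ℝ) < n := by exact_mod_cast hn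
  have hC0 : 0 ≤ C := by simpa using (singularValue_nonneg T₁ 0).trans (hC₁ 0)
  obtain ⟨F₁, hF₁, hTF₁⟩ := exists_rank_le_norm_sub_le_div hC₁ hn
  obtain ⟨F₂, hF₂, hTF₂⟩ := exists_rank_le_norm_sub_le_div hC₂ hn
  have := finiteDimensional_range_of_rank_le hF₁
  have := finiteDimensional_range_of_rank_le hF₂
  have he' : Orthonormal ℂ fun k : Fin n => e k := he.comp _ Fin.val_injective
  set V : Submodule ℂ E := Submodule.span ℂ (Set.range fun k : Fin n => e k) with hV
  have : FiniteDimensional ℂ V := FiniteDimensional.span_of_finite ℂ (Set.finite_range _)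
  have hVdim : Module.finrank ℂ V = n := by
    rw [finrank_span_eq_card he'.linearIndependent, Fintype.card_fin]
  set W : Submodule ℂ E :=
    V ⊔ (LinearMap.range (F₁ : E →ₗ[ℂ] E) ⊔ LinearMap.range (F₂ : E →ₗ[ℂ] E))
  have hWdim : Module.finrank ℂ W ≤ n + 2 * n :=
    (finrank_sup_range_sup_range_le V hF₁ hF₂).trans_eq (by rw [hVdim])
  have hsum₁ := abs_sum_singularValue_sub_traceOn_le h₁ hC₁ hn W hWdim
    (fun x => Submodule.mem_sup_right (Submodule.mem_sup_left ⟨x, rfl⟩)) hTF₁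
  have hsum₂ := abs_sum_singularValue_sub_traceOn_le h₂ hC₂ hn W hWdim
    (fun x => Submodule.mem_sup_right (Submodule.mem_sup_right ⟨x, rfl⟩)) hTF₂
  have htrace : |traceOn W (T₁ - T₂) - traceOn V (T₁ - T₂)| ≤ 2 * C :=
    calc _ ≤ ((2 * n : ℕ) : ℝ) * (C / n) := by
          refine abs_traceOn_sub_traceOn_le (U := V) (W := W) le_sup_left _ (by positivity)
            (hVdim.symm ▸ hWdim) fun v hv => hdiag v fun k hk => ?_
          exact hv _ (Submodule.subset_span ⟨⟨k, hk⟩, rfl⟩)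
      _ = 2 * C := by push_cast; field_simp
  rw [traceOn_eq_sum _ he' hV.symm,
    Fin.sum_univ_eq_sum_range (fun k => (inner ℂ (e k) ((T₁ - T₂) (e k))).re) n,
    traceOn_sub] at htrace
  rw [abs_le] at *
  constructor <;> linarith [hsum₁.1, hsum₁.2, hsum₂.1, hsum₂.2, htrace.1, htrace.2]

end Comparison

/-! ### Operators with reciprocal tails -/

section LogMean

variable {E : Type*} [NormedAddCommGroup E] [InnerProductSpace ℂ E]

theorem tendsto_log_natCast_add_two :
    Tendsto (fun n : ℕ => Real.log ((n : ℝ) + 2)) atTop atTop :=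
  Real.tendsto_log_atTop.comp
    (tendsto_atTop_add_const_right _ _ tendsto_natCast_atTop_atTop)

theorem log_natCast_add_two_pos (n : ℕ) : 0 < Real.log ((n : ℝ) + 2) :=
  Real.log_pos (by linarith [n.cast_nonneg (α := ℝ)])

theorem abs_logMean_le {T : E →L[ℂ] E} {C : ℝ}
    (hC : ∀ k : ℕ, singularValue T k ≤ C / (k + 1)) (n : ℕ) :
    |logMean T n| ≤ C * (1 / Real.log 2 + 1) := by
  have hC0 : 0 ≤ C := by simpa using (singularValue_nonneg T 0).trans (hC 0)
  have hlog2 : 0 < Real.log 2 := Real.log_pos one_lt_two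
  have hlog : Real.log 2 ≤ Real.log (n + 2) :=
    Real.log_le_log two_pos (by linarith [n.cast_nonneg (α := ℝ)])
  have hsum : 0 ≤ ∑ k ∈ Finset.range (n + 1), singularValue T k :=
    Finset.sum_nonneg fun k _ => singularValue_nonneg T k
  rw [logMean, abs_of_nonneg (div_nonneg hsum (log_natCast_add_two_pos n).le),
    div_le_iff₀ (log_natCast_add_two_pos n)]
  calc ∑ k ∈ Finset.range (n + 1), singularValue T k
      ≤ ∑ k ∈ Finset.range (n + 1), C / (k + 1) := Finset.sum_le_sum fun k _ => hC k
    _ = C * ((harmonic (n + 1) : ℚ) : ℝ) := by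
        simp only [harmonic, Rat.cast_sum, Finset.mul_sum, div_eq_mul_inv]
        push_cast
        rfl
    _ ≤ C * (1 + Real.log ((n + 1 : ℕ) : ℝ)) := by
        gcongr
        exact harmonic_le_one_add_log (n + 1)
    _ ≤ C * (1 / Real.log 2 * Real.log (n + 2) + Real.log (n + 2)) := by
        gcongr
        · rwa [one_div, inv_mul_eq_div, one_le_div hlog2]
        · push_cast
          linarith
    _ = C * (1 / Real.log 2 + 1) * Real.log (n + 2) := by ring

theorem dixmierTracePos_sub_eq_of_tendsto (ω : DixmierLimit) {T₁ T₂ : E →L[ℂ] E}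
    (h₁ : ∃ C : ℝ, ∀ n, |logMean T₁ n| ≤ C) (h₂ : ∃ C : ℝ, ∀ n, |logMean T₂ n| ≤ C) {l : ℝ}
    (h : Tendsto (fun n => logMean T₁ n - logMean T₂ n) atTop (𝓝 l)) :
    dixmierTracePos ω T₁ - dixmierTracePos ω T₂ = l := by
  rw [dixmierTracePos, dixmierTracePos, dif_pos h₁, dif_pos h₂, ← map_sub]
  exact ω.eq_lim _ l h

variable [CompleteSpace E]

theorem dixmierTracePos_sub_eq_of_diagonal (ω : DixmierLimit) {T₁ T₂ : E →L[ℂ] E}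
    (h₁ : T₁.IsPositive) (h₂ : T₂.IsPositive) {C : ℝ}
    (hC₁ : ∀ k : ℕ, singularValue T₁ k ≤ C / (k + 1))
    (hC₂ : ∀ k : ℕ, singularValue T₂ k ≤ C / (k + 1)) {e : ℕ → E} (he : Orthonormal ℂ e)
    (hdiag : ∀ n : ℕ, 0 < n → ∀ v : E, (∀ k < n, inner ℂ (e k) v = 0) →
      |(inner ℂ v ((T₁ - T₂) v)).re| ≤ C / n * ‖v‖ ^ 2) {l : ℝ}
    (hl : Tendsto (fun n : ℕ => (∑ k ∈ Finset.range (n + 1),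
      (inner ℂ (e k) ((T₁ - T₂) (e k))).re) / Real.log (n + 2)) atTop (𝓝 l)) :
    dixmierTracePos ω T₁ - dixmierTracePos ω T₂ = l := by
  refine dixmierTracePos_sub_eq_of_tendsto ω ⟨_, abs_logMean_le hC₁⟩ ⟨_, abs_logMean_le hC₂⟩ ?_
  have hdiff : Tendsto (fun n : ℕ => (logMean T₁ n - logMean T₂ n) -
      (∑ k ∈ Finset.range (n + 1), (inner ℂ (e k) ((T₁ - T₂) (e k))).re) / Real.log (n + 2))
      atTop (𝓝 0) := by
    refine squeeze_zero_norm (fun n => ?_)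
      (tendsto_log_natCast_add_two.const_div_atTop (6 * (C + 1)))
    have hlog := log_natCast_add_two_pos n
    rw [logMean, logMean, ← sub_div, ← sub_div, Real.norm_eq_abs, abs_div, abs_of_pos hlog]
    gcongr
    exact abs_sum_singularValue_sub_diagonal_le h₁ h₂ hC₁ hC₂ he n.succ_pos (hdiag _ n.succ_pos)
  simpa using hdiff.add hl

theorem norm_posPart_apply_sq_add {S : E →L[ℂ] E} (hS : IsSelfAdjoint S) (x : E) :
    ‖S⁺ x‖ ^ 2 + ‖S⁻ x‖ ^ 2 = ‖S x‖ ^ 2 := by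
  have hpos : S⁺.IsPositive :=
    (ContinuousLinearMap.nonneg_iff_isPositive _).1 (CFC.posPart_nonneg S)
  have horth : inner ℂ (S⁺ x) (S⁻ x) = 0 :=
    calc inner ℂ (S⁺ x) (S⁻ x) = inner ℂ x ((S⁺ * S⁻) x) := hpos.isSymmetric x (S⁻ x)
      _ = 0 := by rw [CFC.posPart_mul_negPart, zero_apply, inner_zero_right]
  have hsub : S x = S⁺ x - S⁻ x := by rw [← sub_apply, CFC.posPart_sub_negPart S hS]
  rw [hsub, @norm_sub_sq ℂ, horth]
  simp

theorem singularValue_posPart_le {S : E →L[ℂ] E} (hS : IsSelfAdjoint S) (k : ℕ) :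
    singularValue S⁺ k ≤ singularValue S k :=
  singularValue_le_of_norm_apply_le (fun x => le_of_sq_le_sq
    (by linarith [norm_posPart_apply_sq_add hS x, sq_nonneg ‖S⁻ x‖]) (norm_nonneg _)) k

theorem singularValue_negPart_le {S : E →L[ℂ] E} (hS : IsSelfAdjoint S) (k : ℕ) :
    singularValue S⁻ k ≤ singularValue S k :=
  singularValue_le_of_norm_apply_le (fun x => le_of_sq_le_sq
    (by linarith [norm_posPart_apply_sq_add hS x, sq_nonneg ‖S⁺ x‖]) (norm_nonneg _)) k

end LogMean

section ReciprocalTail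

variable {E : Type*} [NormedAddCommGroup E] [InnerProductSpace ℂ E]

/-- `T` has norm at most `C / (n + 1)` on the orthogonal complement of `e 0, …, e (n - 1)`, for
every `n`. Such operators lie in the Dixmier ideal, and their Dixmier traces can be read off the
diagonal entries `⟪e k, T (e k)⟫`. -/
def HasReciprocalTail (e : ℕ → E) (C : ℝ) (T : E →L[ℂ] E) : Prop :=
  ∀ (n : ℕ) (v : E), (∀ k < n, inner ℂ (e k) v = 0) → ‖T v‖ ≤ C / (n + 1) * ‖v‖

namespace HasReciprocalTail

variable {e : ℕ → E} {C : ℝ} {T : E →L[ℂ] E}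

theorem comp_left (hT : HasReciprocalTail e C T) (A : E →L[ℂ] E) :
    HasReciprocalTail e (‖A‖ * C) (A ∘L T) := fun n v hv => by
  calc ‖A (T v)‖ ≤ ‖A‖ * (C / (n + 1) * ‖v‖) := A.le_opNorm_of_le (hT n v hv)
    _ = ‖A‖ * C / (n + 1) * ‖v‖ := by ring

theorem norm_apply_le_of_mem_orthogonal (hT : HasReciprocalTail e C T) {n : ℕ} {v : E}
    (hv : v ∈ (Submodule.span ℂ (Set.range fun k : Fin n => e k))ᗮ) :
    ‖T v‖ ≤ C / (n + 1) * ‖v‖ :=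
  hT n v fun k hk => hv _ (Submodule.subset_span ⟨⟨k, hk⟩, rfl⟩)

theorem const_nonneg (hT : HasReciprocalTail e C T) (he : Orthonormal ℂ e) : 0 ≤ C := by
  simpa [he.1 0] using (norm_nonneg _).trans (hT 0 (e 0) (by simp))

theorem singularValue_le (hT : HasReciprocalTail e C T) (hC : 0 ≤ C) (k : ℕ) :
    singularValue T k ≤ C / (k + 1) := by
  have : FiniteDimensional ℂ (Submodule.span ℂ (Set.range fun j : Fin k => e j)) :=
    FiniteDimensional.span_of_finite ℂ (Set.finite_range _)
  exact singularValue_le_of_orthogonal T _ ((finrank_range_le_card _).trans_eq (Fintype.card_fin k))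
    (by positivity) fun _ => hT.norm_apply_le_of_mem_orthogonal

end HasReciprocalTail

theorem re_inner_realPart_apply [CompleteSpace E] (T : E →L[ℂ] E) (v : E) :
    (inner ℂ v ((ℜ T : E →L[ℂ] E) v)).re = (inner ℂ v (T v)).re := by
  rw [realPart_apply_coe, ContinuousLinearMap.star_eq_adjoint, smul_apply, add_apply,
    ← Complex.coe_smul, inner_smul_right, inner_add_right,
    ContinuousLinearMap.adjoint_inner_right, ← inner_conj_symm (T v) v, Complex.re_ofReal_mul,
    Complex.add_re, Complex.conj_re]
  ring

namespace HasReciprocalTail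

variable [CompleteSpace E] {e : ℕ → E} {C : ℝ} {T : E →L[ℂ] E}

theorem isCompactOperator (hT : HasReciprocalTail e C T) (hC : 0 ≤ C) : IsCompactOperator T := by
  let V (n : ℕ) : Submodule ℂ E := Submodule.span ℂ (Set.range fun j : Fin n => e j)
  have hV (n : ℕ) : FiniteDimensional ℂ (V n) :=
    FiniteDimensional.span_of_finite ℂ (Set.finite_range _)
  have hbound (n : ℕ) : ‖T - T ∘L (V n).starProjection‖ ≤ C / (n + 1) := by
    refine ContinuousLinearMap.opNorm_le_bound _ (by positivity) fun x => ?_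
    have hsub : (T - T ∘L (V n).starProjection) x = T ((V n)ᗮ.starProjection x) := by
      simp [Submodule.starProjection_orthogonal]
    calc ‖(T - T ∘L (V n).starProjection) x‖ ≤ C / (n + 1) * ‖(V n)ᗮ.starProjection x‖ :=
          hsub ▸ hT.norm_apply_le_of_mem_orthogonal (Submodule.starProjection_apply_mem _ _)
      _ ≤ C / (n + 1) * ‖x‖ := by gcongr; exact Submodule.norm_starProjection_apply_le _ _
  refine isCompactOperator_of_tendsto (l := atTop) (F := fun n => T ∘L (V n).starProjection)
    ?_ (Eventually.of_forall fun n => ?_)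
  · rw [tendsto_iff_norm_sub_tendsto_zero]
    refine squeeze_zero (fun _ => norm_nonneg _) (fun n => norm_sub_rev T _ ▸ hbound n) ?_
    simpa [div_eq_mul_one_div C] using
      (tendsto_one_div_add_atTop_nhds_zero_nat (𝕜 := ℝ)).const_mul C
  · have := FiniteDimensional.proper ℂ (V n)
    exact (isCompactOperator_of_locallyCompactSpace_rng (T ∘L (V n).subtypeL)).comp_clm
      (V n).orthogonalProjectionOnto

theorem memDixmierIdeal (hT : HasReciprocalTail e C T) (hC : 0 ≤ C) : MemDixmierIdeal T :=
  ⟨hT.isCompactOperator hC, _, abs_logMean_le (hT.singularValue_le hC)⟩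

theorem singularValue_realPart_le (hT : HasReciprocalTail e C T) (hC : 0 ≤ C) (k : ℕ) :
    singularValue (ℜ T : E →L[ℂ] E) k ≤ 2 * C / (k + 1) := by
  obtain ⟨j, hjk, hkj⟩ : ∃ j, j + j ≤ k ∧ k ≤ j + j + 1 := ⟨k / 2, by omega, by omega⟩
  have hkj' : (k : ℝ) + 1 ≤ 2 * (j + 1) := by
    rw [two_mul]
    exact_mod_cast (show k + 1 ≤ j + 1 + (j + 1) by omega)
  calc singularValue (ℜ T : E →L[ℂ] E) k ≤ singularValue (ℜ T : E →L[ℂ] E) (j + j) :=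
        singularValue_antitone _ hjk
    _ ≤ singularValue T j := HarmonicDixmier.singularValue_realPart_le T j
    _ ≤ C / (j + 1) := hT.singularValue_le hC j
    _ = 2 * C / (2 * (j + 1)) := (mul_div_mul_left _ _ two_ne_zero).symm
    _ ≤ 2 * C / (k + 1) := by gcongr

theorem dixmierTraceSA_realPart (hT : HasReciprocalTail e C T) (he : Orthonormal ℂ e)
    (ω : DixmierLimit) {l : ℝ}
    (hl : Tendsto (fun n : ℕ => (∑ k ∈ Finset.range (n + 1), (inner ℂ (e k) (T (e k))).re) /
      Real.log (n + 2)) atTop (𝓝 l)) :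
    dixmierTraceSA ω (ℜ T : E →L[ℂ] E) = l := by
  have hC : 0 ≤ C := hT.const_nonneg he
  set S : E →L[ℂ] E := (ℜ T : E →L[ℂ] E)
  have hS : IsSelfAdjoint S := (ℜ T).2
  have hsub : S⁺ - S⁻ = S := CFC.posPart_sub_negPart S hS
  have hbound := hT.singularValue_realPart_le hC
  refine dixmierTracePos_sub_eq_of_diagonal ω
    ((ContinuousLinearMap.nonneg_iff_isPositive _).1 (CFC.posPart_nonneg S))
    ((ContinuousLinearMap.nonneg_iff_isPositive _).1 (CFC.negPart_nonneg S))
    (fun k => (singularValue_posPart_le hS k).trans (hbound k))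
    (fun k => (singularValue_negPart_le hS k).trans (hbound k)) he (fun n hn v hv => ?_) ?_
  · have : (0 : ℝ) < n := by exact_mod_cast hn
    rw [hsub, re_inner_realPart_apply]
    calc |(inner ℂ v (T v)).re| ≤ ‖v‖ * ‖T v‖ :=
          (Complex.abs_re_le_norm _).trans (norm_inner_le_norm _ _)
      _ ≤ ‖v‖ * (C / (n + 1) * ‖v‖) := by gcongr; exact hT n v hv
      _ = C / (n + 1) * ‖v‖ ^ 2 := by ring
      _ ≤ 2 * C / n * ‖v‖ ^ 2 := by gcongr <;> linarith
  · simpa only [hsub, S, re_inner_realPart_apply] using hl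

theorem dixmierTrace_eq (hT : HasReciprocalTail e C T) (he : Orthonormal ℂ e)
    (ω : DixmierLimit) {l : ℂ}
    (hl : Tendsto (fun n : ℕ => (∑ k ∈ Finset.range (n + 1), inner ℂ (e k) (T (e k))) /
      (Real.log (n + 2) : ℂ)) atTop (𝓝 l)) :
    dixmierTrace ω T = l := by
  have hre : dixmierTraceSA ω (ℜ T : E →L[ℂ] E) = l.re := by
    refine hT.dixmierTraceSA_realPart he ω ?_
    simpa only [Function.comp_def, Complex.div_ofReal_re, Complex.re_sum] using
      (Complex.continuous_re.tendsto l).comp hl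
  have him : dixmierTraceSA ω (ℑ T : E →L[ℂ] E) = l.im := by
    have hIm : ℑ T = ℜ ((-Complex.I • ContinuousLinearMap.id ℂ E) ∘L T) := by
      rw [ContinuousLinearMap.smul_comp, ContinuousLinearMap.id_comp, neg_smul, map_neg,
        realPart_I_smul, neg_neg]
    rw [hIm]
    refine (hT.comp_left _).dixmierTraceSA_realPart he ω ?_
    simpa [Function.comp_def, Complex.div_ofReal_im, Complex.im_sum, inner_smul_right] using
      (Complex.continuous_im.tendsto l).comp hl
  rw [dixmierTrace, hre, him, mul_comm, Complex.re_add_im]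

end HasReciprocalTail

end ReciprocalTail

/-! ### Diagonal operators -/

section Diagonal

variable {𝕜 E ι : Type*} [RCLike 𝕜] [NormedAddCommGroup E] [InnerProductSpace 𝕜 E]

/-- `D` is the diagonal operator with entries `c i` in the Hilbert basis `b`. The defining
relation is stated on coordinates, so that it applies to every vector at once. -/
def IsDiagonal (b : HilbertBasis ι 𝕜 E) (c : ι → 𝕜) (D : E →L[𝕜] E) : Prop :=
  ∀ i v, inner 𝕜 (b i) (D v) = c i * inner 𝕜 (b i) v

theorem exists_isDiagonal (b : HilbertBasis ι 𝕜 E) {c : ι → 𝕜} {C : ℝ} (hC : 0 ≤ C)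
    (hc : ∀ i, ‖c i‖ ≤ C) : ∃ D : E →L[𝕜] E, IsDiagonal b c D := by
  have hmem (v : E) : Memℓp (fun i => c i * b.repr v i) 2 :=
    ((lp.memℓp (b.repr v)).const_mul (C : 𝕜)).mono' fun i => by
      rw [norm_mul, norm_mul, RCLike.norm_of_nonneg hC]
      exact mul_le_mul_of_nonneg_right (hc i) (norm_nonneg _)
  let D : E →ₗ[𝕜] E :=
    { toFun := fun v => b.repr.symm ⟨fun i => c i * b.repr v i, hmem v⟩
      map_add' := fun v w => by
        rw [← map_add]
        congr 1
        ext i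
        simp only [map_add, lp.coeFn_add, Pi.add_apply, mul_add]
      map_smul' := fun a v => by
        rw [RingHom.id_apply, ← map_smul]
        congr 1
        ext i
        simp [mul_left_comm] }
  have hD (i : ι) (v : E) : inner 𝕜 (b i) (D v) = c i * inner 𝕜 (b i) v := by
    rw [← b.repr_apply_apply, ← b.repr_apply_apply]
    simp [D]
  refine ⟨D.mkContinuous C fun v => ?_, hD⟩
  rw [← RCLike.norm_of_nonneg (K := 𝕜) hC, ← norm_smul]
  refine norm_le_norm_of_norm_inner_le b fun i => ?_
  rw [hD, inner_smul_right, norm_mul, norm_mul, RCLike.norm_of_nonneg hC]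
  exact mul_le_mul_of_nonneg_right (hc i) (norm_nonneg _)

theorem IsDiagonal.apply_basis {b : HilbertBasis ι 𝕜 E} {c : ι → 𝕜} {D : E →L[𝕜] E}
    (hD : IsDiagonal b c D) (i : ι) : D (b i) = c i • b i := by
  classical
  refine ext_inner_hilbertBasis b fun j => ?_
  rw [hD, inner_smul_right, orthonormal_iff_ite.1 b.orthonormal]
  obtain rfl | hij := eq_or_ne j i
  · rfl
  · simp [hij]

theorem IsDiagonal.hasReciprocalTail {E : Type*} [NormedAddCommGroup E] [InnerProductSpace ℂ E]
    {b : HilbertBasis ℕ ℂ E} {c : ℕ → ℂ} {D : E →L[ℂ] E} (hD : IsDiagonal b c D) {C : ℝ}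
    (hC : 0 ≤ C) (hc : ∀ k : ℕ, ‖c k‖ ≤ C / (k + 1)) : HasReciprocalTail b C D := fun n v hv => by
  have hCn : 0 ≤ C / ((n : ℝ) + 1) := by positivity
  rw [← Complex.norm_of_nonneg hCn, ← norm_smul]
  refine norm_le_norm_of_norm_inner_le b fun k => ?_
  rw [hD, inner_smul_right, norm_mul, norm_mul, Complex.norm_of_nonneg hCn]
  obtain hkn | hnk := lt_or_ge k n
  · simp [hv k hkn]
  · gcongr
    exact (hc k).trans (by gcongr)

end Diagonal

/-! ### Polynomials times a Gaussian -/

section PolyGaussian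

open Polynomial

/-- The real function `p(x) exp(-x²/2)`. -/
def polyGaussianFun (p : ℝ[X]) (x : ℝ) : ℝ := p.eval x * Real.exp (-x ^ 2 / 2)

theorem hasDerivAt_polyGaussianFun (p : ℝ[X]) (x : ℝ) :
    HasDerivAt (polyGaussianFun p) (polyGaussianFun (derivative p - X * p) x) x := by
  have hsq : HasDerivAt (fun x : ℝ => -x ^ 2 / 2) (-x) x :=
    ((hasDerivAt_pow 2 x).fun_neg.div_const 2).congr_deriv (by norm_num; ring)
  refine ((p.hasDerivAt x).mul hsq.exp).congr_deriv ?_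
  simp only [polyGaussianFun, eval_sub, eval_mul, eval_X]
  ring

theorem iteratedDeriv_polyGaussianFun (n : ℕ) (p : ℝ[X]) :
    iteratedDeriv n (fun x => (polyGaussianFun p x : ℂ))
      = fun x => (polyGaussianFun ((fun q => derivative q - X * q)^[n] p) x : ℂ) := by
  induction n generalizing p with
  | zero => rfl
  | succ n ih =>
    rw [iteratedDeriv_succ', Function.iterate_succ_apply, ← ih]
    congr 1
    ext x
    exact (hasDerivAt_polyGaussianFun p x).ofReal_comp.deriv

theorem abs_pow_mul_exp_neg_sq_div_two_le (k : ℕ) (x : ℝ) :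
    |x| ^ k * Real.exp (-x ^ 2 / 2) ≤ k.factorial * Real.exp (1 / 2) := by
  have hpow : |x| ^ k ≤ k.factorial * Real.exp |x| := by
    rw [mul_comm, ← div_le_iff₀ (by positivity)]
    exact Real.pow_div_factorial_le_exp _ (abs_nonneg x) k
  calc |x| ^ k * Real.exp (-x ^ 2 / 2)
      ≤ k.factorial * Real.exp |x| * Real.exp (-x ^ 2 / 2) := by gcongr
    _ = k.factorial * Real.exp (|x| + -x ^ 2 / 2) := by rw [Real.exp_add, mul_assoc]
    _ ≤ k.factorial * Real.exp (1 / 2) := by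
        gcongr
        linarith [sq_nonneg (|x| - 1), sq_abs x]

theorem exists_abs_polyGaussianFun_le (p : ℝ[X]) : ∃ C, ∀ x, |polyGaussianFun p x| ≤ C := by
  induction p using Polynomial.induction_on' with
  | add p q hp hq =>
    obtain ⟨C, hC⟩ := hp
    obtain ⟨C', hC'⟩ := hq
    refine ⟨C + C', fun x => ?_⟩
    rw [polyGaussianFun, eval_add, add_mul]
    exact (abs_add_le _ _).trans (add_le_add (hC x) (hC' x))
  | monomial k a =>
    refine ⟨|a| * (k.factorial * Real.exp (1 / 2)), fun x => ?_⟩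
    rw [polyGaussianFun, eval_monomial, abs_mul, abs_mul, Real.abs_exp, abs_pow, mul_assoc]
    exact mul_le_mul_of_nonneg_left (abs_pow_mul_exp_neg_sq_div_two_le k x) (abs_nonneg a)

theorem contDiff_polyGaussianFun (p : ℝ[X]) : ContDiff ℝ (⊤ : ℕ∞) (polyGaussianFun p) := by
  have heval : ContDiff ℝ (⊤ : ℕ∞) (fun x : ℝ => p.eval x) := by
    simpa using p.contDiff_aeval (𝕜 := ℝ) (⊤ : ℕ∞)
  exact heval.mul ((contDiff_id.pow 2).neg.div_const 2).exp

/-- The Schwartz function `p(x) exp(-x²/2)`, depending linearly on the polynomial `p`. -/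
def polyGaussian : ℝ[X] →ₗ[ℝ] 𝓢(ℝ, ℂ) where
  toFun p :=
    { toFun := fun x => (polyGaussianFun p x : ℂ)
      smooth' := Complex.ofRealCLM.contDiff.comp (contDiff_polyGaussianFun p)
      decay' := fun k n => by
        set q := (fun q => derivative q - X * q)^[n] p with hq
        obtain ⟨C, hC⟩ := exists_abs_polyGaussianFun_le (X ^ k * q)
        refine ⟨C, fun x => le_of_eq_of_le ?_ (hC x)⟩
        rw [norm_iteratedFDeriv_eq_norm_iteratedDeriv, iteratedDeriv_polyGaussianFun, ← hq,
          Complex.norm_real, polyGaussianFun, polyGaussianFun, eval_mul, eval_pow, eval_X,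
          mul_assoc, abs_mul (x ^ k), abs_pow, Real.norm_eq_abs, Real.norm_eq_abs] }
  map_add' p q := by
    ext x
    change ((polyGaussianFun (p + q) x : ℝ) : ℂ) = polyGaussianFun p x + polyGaussianFun q x
    simp [polyGaussianFun, add_mul]
  map_smul' a p := by
    ext x
    change ((polyGaussianFun (a • p) x : ℝ) : ℂ) = a • (polyGaussianFun p x : ℂ)
    simp [polyGaussianFun, mul_assoc]

theorem polyGaussian_apply (p : ℝ[X]) (x : ℝ) : polyGaussian p x = (polyGaussianFun p x : ℂ) := rfl

theorem deriv_polyGaussian (p : ℝ[X]) :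
    deriv (polyGaussian p) = polyGaussian (derivative p - X * p) :=
  funext fun x => (hasDerivAt_polyGaussianFun p x).ofReal_comp.deriv

theorem schwartzOscillator_polyGaussian (p : ℝ[X]) :
    schwartzOscillator (polyGaussian p)
      = polyGaussian (p + 2 * X * derivative p - derivative (derivative p)) := by
  ext x
  rw [schwartzOscillator_apply, deriv_polyGaussian, deriv_polyGaussian]
  simp only [polyGaussian_apply, polyGaussianFun, derivative_sub, derivative_mul, derivative_X,
    eval_sub, eval_add, eval_mul, eval_X, eval_one, eval_ofNat]
  push_cast
  ring

/-! ### Inner products with Schwartz functions -/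

theorem coeFn_schwartzToL2 (φ : 𝓢(ℝ, ℂ)) : schwartzToL2 φ =ᵐ[volume] φ :=
  φ.coeFn_toLp 2 volume

theorem integrable_schwartz_mul (φ ψ : 𝓢(ℝ, ℂ)) : Integrable fun x => φ x * ψ x :=
  (SchwartzMap.memLp φ 2 volume).integrable_mul (SchwartzMap.memLp ψ 2 volume)

/-- `p(x) exp(-x²/2)` as an element of `L²(ℝ)`. -/
def polyGaussianL2 : ℝ[X] →ₗ[ℝ] L2 := schwartzToL2.restrictScalars ℝ ∘ₗ polyGaussian

theorem polyGaussianL2_apply (p : ℝ[X]) : polyGaussianL2 p = schwartzToL2 (polyGaussian p) := rfl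

theorem inner_polyGaussianL2 (p : ℝ[X]) (v : L2) :
    inner ℂ (polyGaussianL2 p) v = ∫ x, polyGaussian p x * v x := by
  rw [L2.inner_def]
  refine integral_congr_ae ?_
  filter_upwards [coeFn_schwartzToL2 (polyGaussian p)] with x hx
  rw [polyGaussianL2_apply, hx, RCLike.inner_apply, polyGaussian_apply, Complex.conj_ofReal,
    mul_comm]

theorem inner_polyGaussianL2_schwartzToL2 (p : ℝ[X]) (ψ : 𝓢(ℝ, ℂ)) :
    inner ℂ (polyGaussianL2 p) (schwartzToL2 ψ) = ∫ x, polyGaussian p x * ψ x := by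
  rw [inner_polyGaussianL2]
  refine integral_congr_ae ?_
  filter_upwards [coeFn_schwartzToL2 ψ] with x hx
  rw [hx]

theorem inner_polyGaussianL2_X_mul (p q : ℝ[X]) :
    inner ℂ (polyGaussianL2 (X * p)) (polyGaussianL2 q)
      = inner ℂ (polyGaussianL2 p) (polyGaussianL2 (X * q)) := by
  rw [polyGaussianL2_apply q, polyGaussianL2_apply (X * q), inner_polyGaussianL2_schwartzToL2,
    inner_polyGaussianL2_schwartzToL2]
  refine integral_congr_ae (Eventually.of_forall fun x => ?_)
  simp only [polyGaussian_apply, polyGaussianFun, eval_mul, eval_X]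
  push_cast
  ring

theorem inner_polyGaussianL2_derivative_sub_X_mul (p q : ℝ[X]) :
    inner ℂ (polyGaussianL2 (derivative p - X * p)) (polyGaussianL2 q)
      = -inner ℂ (polyGaussianL2 p) (polyGaussianL2 (derivative q - X * q)) := by
  simp only [polyGaussianL2_apply q, polyGaussianL2_apply (derivative q - X * q),
    inner_polyGaussianL2_schwartzToL2, ← deriv_polyGaussian]
  rw [SchwartzMap.integral_mul_deriv_eq_neg_deriv_mul, neg_neg]

theorem inner_polyGaussianL2_derivative (p q : ℝ[X]) :
    inner ℂ (polyGaussianL2 (derivative p)) (polyGaussianL2 q)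
      = inner ℂ (polyGaussianL2 p) (polyGaussianL2 (2 * X * q - derivative q)) := by
  rw [← sub_add_cancel (derivative p) (X * p), map_add, inner_add_left,
    inner_polyGaussianL2_derivative_sub_X_mul, inner_polyGaussianL2_X_mul, neg_add_eq_sub,
    ← inner_sub_right, ← map_sub]
  congr 2
  ring

theorem inner_polyGaussianL2_one_one :
    inner ℂ (polyGaussianL2 1) (polyGaussianL2 1) = (√Real.pi : ℝ) := by
  have hgauss := integral_gaussian 1
  rw [div_one] at hgauss
  refine (inner_polyGaussianL2_schwartzToL2 1 _).trans ?_
  rw [← hgauss, ← integral_complex_ofReal]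
  refine integral_congr_ae (Eventually.of_forall fun x => ?_)
  simp only [polyGaussian_apply, polyGaussianFun, eval_one, one_mul]
  rw [← Complex.ofReal_mul, ← Real.exp_add]
  congr 2
  ring

theorem integral_mul_schwartzOscillator (φ ψ : 𝓢(ℝ, ℂ)) :
    ∫ x, φ x * schwartzOscillator ψ x = ∫ x, schwartzOscillator φ x * ψ x := by
  have hderiv (χ : 𝓢(ℝ, ℂ)) : ⇑(SchwartzMap.derivCLM ℂ ℂ χ) = deriv χ := by ext y; simp
  set φ' : 𝓢(ℝ, ℂ) := SchwartzMap.derivCLM ℂ ℂ φ with hφ'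
  set ψ' : 𝓢(ℝ, ℂ) := SchwartzMap.derivCLM ℂ ℂ ψ with hψ'
  have hparts : ∫ x, φ x * deriv (deriv ψ) x = ∫ x, deriv (deriv φ) x * ψ x := by
    have hφψ' := SchwartzMap.integral_mul_deriv_eq_neg_deriv_mul φ ψ'
    have hφ'ψ := SchwartzMap.integral_mul_deriv_eq_neg_deriv_mul φ' ψ
    rw [hψ', hderiv] at hφψ'
    rw [hφ', hderiv] at hφ'ψ
    rw [hφψ', hφ'ψ, neg_neg]
  have hintψ := integrable_schwartz_mul φ (SchwartzMap.derivCLM ℂ ℂ ψ')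
  have hintφ := integrable_schwartz_mul (SchwartzMap.derivCLM ℂ ℂ φ') ψ
  rw [hderiv, hψ', hderiv] at hintψ
  rw [hderiv, hφ', hderiv] at hintφ
  refine add_right_cancel (b := ∫ x, φ x * deriv (deriv ψ) x) ?_
  conv_rhs => rw [hparts]
  rw [← integral_add (integrable_schwartz_mul _ _) hintψ,
    ← integral_add (integrable_schwartz_mul _ _) hintφ]
  refine integral_congr_ae (Eventually.of_forall fun x => ?_)
  simp only [schwartzOscillator_apply]
  ring

theorem inner_polyGaussianL2_schwartzOscillator (p : ℝ[X]) (ψ : 𝓢(ℝ, ℂ)) :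
    inner ℂ (polyGaussianL2 p) (schwartzToL2 (schwartzOscillator ψ))
      = inner ℂ (polyGaussianL2 (p + 2 * X * derivative p - derivative (derivative p)))
        (schwartzToL2 ψ) := by
  rw [inner_polyGaussianL2_schwartzToL2, inner_polyGaussianL2_schwartzToL2,
    integral_mul_schwartzOscillator, schwartzOscillator_polyGaussian]

end PolyGaussian

/-! ### Hermite functions -/

section Hermite

open Polynomial

/-- The physicists' Hermite polynomials `1, 2x, 4x² - 2, …`, orthogonal for the weight
`exp(-x²)`; `Polynomial.hermite` are the probabilists' ones, for the weight `exp(-x²/2)`. -/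
def hermitePoly : ℕ → ℝ[X]
  | 0 => 1
  | n + 1 => 2 * X * hermitePoly n - derivative (hermitePoly n)

theorem hermitePoly_succ (n : ℕ) :
    hermitePoly (n + 1) = 2 * X * hermitePoly n - derivative (hermitePoly n) := rfl

theorem derivative_hermitePoly_succ (n : ℕ) :
    derivative (hermitePoly (n + 1)) = (2 * (n + 1) : ℝ) • hermitePoly n := by
  induction n with
  | zero => simp [hermitePoly, smul_eq_C_mul, ← C_ofNat]
  | succ n ih =>
    have htwoX : derivative (2 * X : ℝ[X]) = 2 := by simp
    rw [hermitePoly_succ (n + 1), derivative_sub, derivative_mul, ih, derivative_smul, htwoX,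
      mul_smul_comm, add_sub_assoc, ← smul_sub, ← hermitePoly_succ]
    simp only [smul_eq_C_mul]
    push_cast
    simp only [map_mul, map_add, map_one, C_ofNat]
    ring

theorem hermitePoly_succ_succ (n : ℕ) :
    hermitePoly (n + 2) = 2 * X * hermitePoly (n + 1) - (2 * (n + 1) : ℝ) • hermitePoly n := by
  rw [hermitePoly_succ (n + 1), derivative_hermitePoly_succ]

theorem hermitePoly_differential_equation (n : ℕ) :
    hermitePoly n + 2 * X * derivative (hermitePoly n) - derivative (derivative (hermitePoly n))
      = (2 * n + 1 : ℝ) • hermitePoly n := by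
  cases n with
  | zero => simp [hermitePoly]
  | succ n =>
    rw [derivative_hermitePoly_succ, derivative_smul, mul_smul_comm, add_sub_assoc, ← smul_sub,
      ← hermitePoly_succ]
    simp only [smul_eq_C_mul]
    push_cast
    simp only [map_mul, map_add, map_one, C_ofNat]
    ring

theorem inner_polyGaussianL2_hermitePoly_succ_succ (m n : ℕ) :
    inner ℂ (polyGaussianL2 (hermitePoly (m + 1))) (polyGaussianL2 (hermitePoly (n + 1)))
      = (2 * (m + 1) : ℝ)
        * inner ℂ (polyGaussianL2 (hermitePoly m)) (polyGaussianL2 (hermitePoly n)) := by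
  rw [hermitePoly_succ n, ← inner_polyGaussianL2_derivative, derivative_hermitePoly_succ, map_smul,
    inner_smul_left_eq_smul, Complex.real_smul]

theorem inner_polyGaussianL2_hermitePoly_zero_succ (n : ℕ) :
    inner ℂ (polyGaussianL2 (hermitePoly 0)) (polyGaussianL2 (hermitePoly (n + 1))) = 0 := by
  rw [hermitePoly_succ n, ← inner_polyGaussianL2_derivative, hermitePoly, derivative_one, map_zero,
    inner_zero_left]

theorem inner_polyGaussianL2_hermitePoly_of_ne {m n : ℕ} (hmn : m ≠ n) :
    inner ℂ (polyGaussianL2 (hermitePoly m)) (polyGaussianL2 (hermitePoly n)) = 0 := by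
  induction m generalizing n with
  | zero =>
    obtain ⟨n, rfl⟩ := Nat.exists_eq_succ_of_ne_zero hmn.symm
    exact inner_polyGaussianL2_hermitePoly_zero_succ n
  | succ m ih =>
    cases n with
    | zero => exact inner_eq_zero_symm.1 (inner_polyGaussianL2_hermitePoly_zero_succ m)
    | succ n => rw [inner_polyGaussianL2_hermitePoly_succ_succ, ih (by omega), mul_zero]

theorem inner_polyGaussianL2_hermitePoly_self (n : ℕ) :
    inner ℂ (polyGaussianL2 (hermitePoly n)) (polyGaussianL2 (hermitePoly n))
      = (√Real.pi * (2 ^ n * n.factorial) : ℝ) := by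
  induction n with
  | zero => simpa [hermitePoly] using inner_polyGaussianL2_one_one
  | succ n ih =>
    rw [inner_polyGaussianL2_hermitePoly_succ_succ, ih, Nat.factorial_succ]
    push_cast
    ring

theorem X_mul_mem_span_hermitePoly {p : ℝ[X]}
    (hp : p ∈ Submodule.span ℝ (Set.range hermitePoly)) :
    X * p ∈ Submodule.span ℝ (Set.range hermitePoly) := by
  set S := Submodule.span ℝ (Set.range hermitePoly)
  have hmem (n : ℕ) : hermitePoly n ∈ S := Submodule.subset_span ⟨n, rfl⟩
  induction hp using Submodule.span_induction with
  | mem p hp =>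
    obtain ⟨n, rfl⟩ := hp
    have hderiv : derivative (hermitePoly n) ∈ S := by
      cases n with
      | zero => simp [hermitePoly]
      | succ n =>
        rw [derivative_hermitePoly_succ]
        exact S.smul_mem _ (hmem n)
    have hX : X * hermitePoly n
        = (2⁻¹ : ℝ) • (hermitePoly (n + 1) + derivative (hermitePoly n)) := by
      rw [hermitePoly_succ, sub_add_cancel, mul_assoc, smul_eq_C_mul, ← mul_assoc, ← C_ofNat,
        ← C_mul]
      norm_num
    rw [hX]
    exact S.smul_mem _ (S.add_mem (hmem _) hderiv)
  | zero => simp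
  | add p q _ _ hp hq => rw [mul_add]; exact S.add_mem hp hq
  | smul a p _ hp => rw [mul_smul_comm]; exact S.smul_mem a hp

theorem span_hermitePoly : Submodule.span ℝ (Set.range hermitePoly) = ⊤ := by
  refine Submodule.eq_top_iff'.2 fun p => ?_
  induction p using Polynomial.induction_on with
  | C a =>
    simpa only [hermitePoly, smul_eq_C_mul, mul_one] using
      Submodule.smul_mem _ a (Submodule.subset_span ⟨0, rfl⟩ :
        hermitePoly 0 ∈ Submodule.span ℝ (Set.range hermitePoly))
  | add p q hp hq => exact Submodule.add_mem _ hp hq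
  | monomial n a hn =>
    have := X_mul_mem_span_hermitePoly hn
    rwa [mul_left_comm, ← pow_succ'] at this

/-- The normalization constant of the `n`-th Hermite function. -/
def hermiteNorm (n : ℕ) : ℝ := √(√Real.pi * (2 ^ n * n.factorial))

theorem hermiteNorm_pos (n : ℕ) : 0 < hermiteNorm n := by
  unfold hermiteNorm
  positivity

theorem hermiteNorm_sq (n : ℕ) : hermiteNorm n ^ 2 = √Real.pi * (2 ^ n * n.factorial) :=
  Real.sq_sqrt (by positivity)

/-- The `n`-th Hermite function, normalized in `L²(ℝ)`. -/
def hermiteFun (n : ℕ) : 𝓢(ℝ, ℂ) := polyGaussian ((hermiteNorm n)⁻¹ • hermitePoly n)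

theorem schwartzToL2_hermiteFun (n : ℕ) :
    schwartzToL2 (hermiteFun n) = (hermiteNorm n)⁻¹ • polyGaussianL2 (hermitePoly n) :=
  polyGaussianL2.map_smul _ _

theorem orthonormal_hermiteFun : Orthonormal ℂ fun n => schwartzToL2 (hermiteFun n) := by
  refine orthonormal_iff_ite.2 fun m n => ?_
  simp only [schwartzToL2_hermiteFun, inner_smul_left_eq_smul, inner_smul_right_eq_smul]
  split_ifs with hmn
  · have := (hermiteNorm_pos n).ne'
    rw [hmn, inner_polyGaussianL2_hermitePoly_self, ← hermiteNorm_sq, Complex.real_smul,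
      Complex.real_smul, ← Complex.ofReal_mul, ← Complex.ofReal_mul, ← Complex.ofReal_one]
    congr 1
    field_simp
  · rw [inner_polyGaussianL2_hermitePoly_of_ne hmn, smul_zero, smul_zero]

theorem schwartzOscillator_hermiteFun (n : ℕ) :
    schwartzOscillator (hermiteFun n) = (2 * n + 1 : ℂ) • hermiteFun n := by
  ext x
  rw [hermiteFun, schwartzOscillator_polyGaussian, derivative_smul, derivative_smul, mul_smul_comm,
    ← smul_add, ← smul_sub, hermitePoly_differential_equation, smul_comm, map_smul]
  change ((2 * n + 1 : ℝ) : ℂ) * _ = _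
  push_cast
  rfl

theorem inner_hermiteFun_schwartzOscillator (n : ℕ) (ψ : 𝓢(ℝ, ℂ)) :
    inner ℂ (schwartzToL2 (hermiteFun n)) (schwartzToL2 (schwartzOscillator ψ))
      = (2 * n + 1 : ℂ) * inner ℂ (schwartzToL2 (hermiteFun n)) (schwartzToL2 ψ) := by
  simp only [schwartzToL2_hermiteFun, inner_smul_left_eq_smul,
    inner_polyGaussianL2_schwartzOscillator, hermitePoly_differential_equation, map_smul]
  rw [smul_comm, Complex.real_smul]
  push_cast
  rfl

/-! ### Completeness of the Hermite functions -/

theorem ae_eq_zero_of_fourier_eq_zero {h : ℝ → ℂ} (hi : Integrable h)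
    (hF : FourierTransform.fourier h = 0) : ∀ᵐ x, h x = 0 := by
  refine ae_eq_zero_of_integral_contDiff_smul_eq_zero hi.locallyIntegrable fun g hg hgc => ?_
  let G : 𝓢(ℝ, ℂ) := (hgc.comp_left Complex.ofReal_zero : HasCompactSupport fun x =>
    (g x : ℂ)).toSchwartzMap (Complex.ofRealCLM.contDiff.comp hg)
  let ψ : 𝓢(ℝ, ℂ) := FourierTransformInv.fourierInv G
  have hψ : VectorFourier.fourierIntegral Real.fourierChar volume (innerₗ ℝ).flip ψ = G := by
    rw [flip_innerₗ]
    have hFψ : FourierTransform.fourier ψ = G := FourierTransform.fourier_fourierInv_eq G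
    exact congrArg DFunLike.coe hFψ
  have hfourier : VectorFourier.fourierIntegral Real.fourierChar volume (innerₗ ℝ) h = 0 := hF
  have hswap := VectorFourier.integral_fourierIntegral_smul_eq_flip (L := innerₗ ℝ)
    Real.continuous_fourierChar continuous_inner hi (SchwartzMap.integrable (μ := volume) ψ)
  simp only [hfourier, hψ, Pi.zero_apply, smul_eq_mul, zero_mul, integral_zero] at hswap
  rw [hswap]
  congr 1
  ext x
  rw [Complex.real_smul, mul_comm]
  rfl

theorem integrable_exp_abs_mul_exp_neg_sq_mul {v : ℝ → ℂ} (hv : MemLp v 2) (s : ℝ) :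
    Integrable fun x : ℝ => Real.exp |s * x| * (Real.exp (-x ^ 2 / 2) * ‖v x‖) := by
  have hgauss : MemLp (fun x : ℝ => Real.exp (-x ^ 2 / 4)) 2 := by
    rw [memLp_two_iff_integrable_sq (by fun_prop)]
    refine (integrable_exp_neg_mul_sq (b := 1 / 2) (by norm_num)).congr
      (Eventually.of_forall fun x => ?_)
    simp only
    rw [← Real.exp_nat_mul]
    congr 1
    push_cast
    ring
  refine ((hgauss.integrable_mul hv.norm).const_mul (Real.exp (s ^ 2))).mono'
    ((Continuous.aestronglyMeasurable (by fun_prop)).mul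
      ((Continuous.aestronglyMeasurable (by fun_prop)).mul hv.1.norm))
    (Eventually.of_forall fun x => ?_)
  simp only [Pi.mul_apply]
  rw [Real.norm_of_nonneg (by positivity), ← mul_assoc, ← mul_assoc, ← Real.exp_add,
    ← Real.exp_add]
  refine mul_le_mul_of_nonneg_right (Real.exp_le_exp.2 ?_) (norm_nonneg _)
  rw [abs_mul]
  nlinarith [sq_nonneg (|s| - |x| / 2), sq_abs s, sq_abs x]

theorem hasSum_integral_pow_mul_I_div_factorial {h : ℝ → ℂ} (hmeas : AEStronglyMeasurable h)
    {s : ℝ} (hi : Integrable fun x => Real.exp |s * x| * ‖h x‖) :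
    HasSum (fun n : ℕ => ∫ x : ℝ, ((s * x : ℝ) * Complex.I) ^ n / n.factorial * h x)
      (∫ x : ℝ, Complex.exp ((s * x : ℝ) * Complex.I) * h x) := by
  have hexp (x : ℝ) : HasSum (fun n : ℕ => |s * x| ^ n / n.factorial) (Real.exp |s * x|) := by
    rw [Real.exp_eq_exp_ℝ]
    exact NormedSpace.expSeries_div_hasSum_exp _
  refine hasSum_integral_of_dominated_convergence
    (fun n x => |s * x| ^ n / n.factorial * ‖h x‖)
    (fun n => (Continuous.aestronglyMeasurable (by fun_prop)).mul hmeas)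
    (fun n => Eventually.of_forall fun x => by simp)
    (Eventually.of_forall fun x => (hexp x).summable.mul_right _) ?_
    (Eventually.of_forall fun x => HasSum.mul_right _ ?_)
  · simpa only [tsum_mul_right, (hexp _).tsum_eq] using hi
  · rw [Complex.exp_eq_exp_ℂ]
    exact NormedSpace.expSeries_div_hasSum_exp _

theorem ae_eq_zero_of_integral_polyGaussian_eq_zero {v : ℝ → ℂ} (hv : MemLp v 2)
    (moments_eq_zero : ∀ p : ℝ[X], ∫ x, polyGaussian p x * v x = 0) : ∀ᵐ x, v x = 0 := by
  set h : ℝ → ℂ := fun x => (Real.exp (-x ^ 2 / 2) : ℂ) * v x with h_def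
  have hmeas : AEStronglyMeasurable h :=
    (Continuous.aestronglyMeasurable (by fun_prop)).mul hv.1
  have hint (s : ℝ) : Integrable fun x => Real.exp |s * x| * ‖h x‖ := by
    simpa only [h_def, norm_mul, Complex.norm_real, Real.norm_of_nonneg (Real.exp_pos _).le] using
      integrable_exp_abs_mul_exp_neg_sq_mul hv s
  have hmoment (s : ℝ) (n : ℕ) :
      ∫ x : ℝ, ((s * x : ℝ) * Complex.I) ^ n / n.factorial * h x = 0 := by
    calc ∫ x : ℝ, ((s * x : ℝ) * Complex.I) ^ n / n.factorial * h x
        = ∫ x : ℝ, (s * Complex.I) ^ n / n.factorial * (polyGaussian (X ^ n) x * v x) := by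
          refine integral_congr_ae (Eventually.of_forall fun x => ?_)
          simp only [h_def, polyGaussian_apply, polyGaussianFun, eval_pow, eval_X]
          push_cast
          ring
      _ = 0 := by rw [integral_const_mul, moments_eq_zero, mul_zero]
  have hfourier : FourierTransform.fourier h = 0 := by
    ext w
    have hsum := hasSum_integral_pow_mul_I_div_factorial hmeas (hint (-2 * Real.pi * w))
    simp only [hmoment] at hsum
    rw [Real.fourier_real_eq_integral_exp_smul, Pi.zero_apply, ← hsum.unique hasSum_zero]
    refine integral_congr_ae (Eventually.of_forall fun x => ?_)
    simp only [smul_eq_mul, mul_right_comm _ w]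
  have hhi : Integrable h := by
    rw [← integrable_norm_iff hmeas]
    simpa using hint 0
  filter_upwards [ae_eq_zero_of_fourier_eq_zero hhi hfourier] with x hx
  exact (mul_eq_zero.1 hx).resolve_left (by simp)

theorem span_hermiteFun_orthogonal :
    (Submodule.span ℂ (Set.range fun n => schwartzToL2 (hermiteFun n)))ᗮ = ⊥ := by
  refine (Submodule.eq_bot_iff _).2 fun v hv => ?_
  have hhermite (n : ℕ) : inner ℂ (polyGaussianL2 (hermitePoly n)) v = 0 := by
    have hn : inner ℂ (schwartzToL2 (hermiteFun n)) v = 0 :=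
      hv _ (Submodule.subset_span ⟨n, rfl⟩)
    rw [schwartzToL2_hermiteFun, inner_smul_left_eq_smul] at hn
    exact (smul_eq_zero.1 hn).resolve_left (inv_ne_zero (hermiteNorm_pos n).ne')
  have hpoly (p : ℝ[X]) : inner ℂ (polyGaussianL2 p) v = 0 := by
    have hp : p ∈ Submodule.span ℝ (Set.range hermitePoly) := span_hermitePoly ▸ Submodule.mem_top
    induction hp using Submodule.span_induction with
    | mem p hp => obtain ⟨n, rfl⟩ := hp; exact hhermite n
    | zero => rw [map_zero, inner_zero_left]
    | add p q _ _ hp hq => rw [map_add, inner_add_left, hp, hq, add_zero]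
    | smul a p _ hp => rw [map_smul, inner_smul_left_eq_smul, hp, smul_zero]
  exact Lp.eq_zero_iff_ae_eq_zero.2 <| ae_eq_zero_of_integral_polyGaussian_eq_zero (Lp.memLp v)
    fun p => by rw [← inner_polyGaussianL2, hpoly]

/-- The Hilbert basis of `L²(ℝ)` formed by the Hermite functions. -/
def hermiteBasis : HilbertBasis ℕ ℂ L2 :=
  HilbertBasis.mkOfOrthogonalEqBot orthonormal_hermiteFun span_hermiteFun_orthogonal

theorem hermiteBasis_apply (n : ℕ) : hermiteBasis n = schwartzToL2 (hermiteFun n) := by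
  rw [hermiteBasis, HilbertBasis.coe_mkOfOrthogonalEqBot]

end Hermite

/-! ### The inverse of the harmonic oscillator -/

section Inverse

variable {𝕜 E F : Type*} [NontriviallyNormedField 𝕜] [NormedAddCommGroup E] [NormedSpace 𝕜 E]
  [NormedAddCommGroup F] [NormedSpace 𝕜 F]

theorem topologicalClosure_graph_eq_ker {A : E →ₗ.[𝕜] F} {D : F →L[𝕜] E} {s : Set F}
    (hDA : ∀ z ∈ A.graph, D z.2 = z.1) (hAD : ∀ v ∈ s, (D v, v) ∈ A.graph)
    (hs : (Submodule.span 𝕜 s).topologicalClosure = ⊤) :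
    A.graph.topologicalClosure =
      (D ∘L ContinuousLinearMap.snd 𝕜 E F - ContinuousLinearMap.fst 𝕜 E F).ker := by
  refine le_antisymm (Submodule.topologicalClosure_minimal _ (fun z hz => ?_)
    (ContinuousLinearMap.isClosed_ker _)) fun z hz => ?_
  · simpa [sub_eq_zero] using hDA z hz
  · let G : Submodule 𝕜 F :=
      A.graph.topologicalClosure.comap ((D : F →ₗ[𝕜] E).prod LinearMap.id)
    have hGc : IsClosed (G : Set F) :=
      (Submodule.isClosed_topologicalClosure _).preimage (D.continuous.prodMk continuous_id)
    have hsG : Submodule.span 𝕜 s ≤ G :=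
      Submodule.span_le.2 fun v hv => Submodule.le_topologicalClosure _ (hAD v hv)
    have hz' : z = (D z.2, z.2) :=
      Prod.ext (by simpa [sub_eq_zero] using hz : D z.2 = z.1).symm rfl
    have hzG : z.2 ∈ G :=
      Submodule.topologicalClosure_minimal _ hsG hGc (hs ▸ Submodule.mem_top)
    rw [hz']
    exact hzG

theorem mem_graph_closure_iff {A : E →ₗ.[𝕜] F} {D : F →L[𝕜] E} {s : Set F}
    (hDA : ∀ z ∈ A.graph, D z.2 = z.1) (hAD : ∀ v ∈ s, (D v, v) ∈ A.graph)
    (hs : (Submodule.span 𝕜 s).topologicalClosure = ⊤) (hD : Function.Injective D) {z : E × F} :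
    z ∈ A.closure.graph ↔ D z.2 = z.1 := by
  have hker := topologicalClosure_graph_eq_ker hDA hAD hs
  have hclosable : A.IsClosable := by
    refine ⟨Submodule.toLinearPMap _, (hker.trans (Submodule.toLinearPMap_graph_eq _ ?_).symm)⟩
    intro w hw hw₁
    have hDw : D w.2 = w.1 := by simpa [sub_eq_zero] using hw
    exact hD (by rw [hDw, hw₁, map_zero])
  rw [← hclosable.graph_closure_eq_closure_graph, hker]
  simp [sub_eq_zero]

theorem mem_graph_oscillatorOnSchwartz {z : L2 × L2} : z ∈ oscillatorOnSchwartz.graph ↔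
    ∃ ψ : 𝓢(ℝ, ℂ), z = (schwartzToL2 ψ, schwartzToL2 (schwartzOscillator ψ)) := by
  have hval (ψ : 𝓢(ℝ, ℂ)) (hψ : schwartzToL2 ψ ∈ oscillatorOnSchwartz.domain) :
      oscillatorOnSchwartz ⟨schwartzToL2 ψ, hψ⟩ = schwartzToL2 (schwartzOscillator ψ) := by
    have hsymm : (LinearEquiv.ofInjective schwartzToL2 schwartzToL2_injective).symm
        ⟨schwartzToL2 ψ, hψ⟩ = ψ := (LinearEquiv.symm_apply_eq _).2 rfl
    exact congrArg (fun φ => schwartzToL2 (schwartzOscillator φ)) hsymm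
  rw [LinearPMap.mem_graph_iff']
  constructor
  · rintro ⟨⟨_, ψ, rfl⟩, rfl⟩
    exact ⟨ψ, Prod.ext rfl (hval ψ _)⟩
  · rintro ⟨ψ, rfl⟩
    exact ⟨⟨schwartzToL2 ψ, ψ, rfl⟩, Prod.ext rfl (hval ψ _)⟩

theorem IsBoundedInverse.unique {A : L2 →ₗ.[ℂ] L2} {R R' : L2 →L[ℂ] L2}
    (h : IsBoundedInverse A R) (h' : IsBoundedInverse A R') : R = R' := by
  ext1 v
  exact ((h' (R v) v).1 ((h (R v) v).2 rfl)).symm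

theorem isBoundedInverse_harmonicOscillator {D : L2 →L[ℂ] L2}
    (hD : IsDiagonal hermiteBasis (fun k => (2 * k + 1 : ℂ)⁻¹) D) :
    IsBoundedInverse harmonicOscillator D := by
  have hne (k : ℕ) : (2 * k + 1 : ℂ) ≠ 0 := by exact_mod_cast (2 * k).succ_ne_zero
  refine fun u v => mem_graph_closure_iff (s := Set.range hermiteBasis) (fun z hz => ?_) ?_
    hermiteBasis.dense_span ?_
  · obtain ⟨ψ, rfl⟩ := mem_graph_oscillatorOnSchwartz.1 hz
    refine ext_inner_hilbertBasis hermiteBasis fun k => ?_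
    rw [hD, hermiteBasis_apply, inner_hermiteFun_schwartzOscillator, inv_mul_cancel_left₀ (hne k)]
  · rintro _ ⟨k, rfl⟩
    refine mem_graph_oscillatorOnSchwartz.2 ⟨(2 * k + 1 : ℂ)⁻¹ • hermiteFun k, Prod.ext ?_ ?_⟩
    · rw [hD.apply_basis, hermiteBasis_apply, map_smul]
    · dsimp only
      rw [map_smul, map_smul, hermiteBasis_apply, schwartzOscillator_hermiteFun, map_smul,
        inv_smul_smul₀ (hne k)]
  · refine (injective_iff_map_eq_zero D).2 fun w hw => ext_inner_hilbertBasis hermiteBasis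
      fun k => ?_
    have hk := hD k w
    rw [hw, inner_zero_right, zero_eq_mul] at hk
    rw [inner_zero_right, hk.resolve_left (inv_ne_zero (hne k))]

theorem norm_two_mul_add_one_inv_le (k : ℕ) : ‖(2 * k + 1 : ℂ)⁻¹‖ ≤ 1 / (k + 1) := by
  have hnorm : ‖(2 * k + 1 : ℂ)‖ = 2 * k + 1 := by
    exact_mod_cast Complex.norm_natCast (2 * k + 1)
  rw [norm_inv, hnorm, ← one_div]
  gcongr
  linarith [k.cast_nonneg (α := ℝ)]

theorem isDiagonal_oscillatorInv :
    IsDiagonal hermiteBasis (fun k => (2 * k + 1 : ℂ)⁻¹) oscillatorInv := by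
  obtain ⟨D, hD⟩ := exists_isDiagonal hermiteBasis (c := fun k => (2 * k + 1 : ℂ)⁻¹) zero_le_one
    fun k => (norm_two_mul_add_one_inv_le k).trans (div_le_one_of_le₀ (by simp) (by positivity))
  have hex : ∃ R : L2 →L[ℂ] L2, IsBoundedInverse harmonicOscillator R :=
    ⟨D, isBoundedInverse_harmonicOscillator hD⟩
  have hinv : oscillatorInv = D := by
    rw [oscillatorInv, dif_pos hex]
    exact hex.choose_spec.unique (isBoundedInverse_harmonicOscillator hD)
  rwa [hinv]

end Inverse

/-! ### Power series on the unit interval -/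

section PowerSeries

variable {F : Type*} [NormedAddCommGroup F]

/-- The power series with coefficients `c` has radius of convergence at least `1`, stated through
absolute summability at every point of `[0, 1)`. -/
def SummableOnUnitBall (c : ℕ → F) : Prop :=
  ∀ r : ℝ, 0 ≤ r → r < 1 → Summable fun n => ‖c n‖ * r ^ n

theorem summableOnUnitBall_of_norm_le {c : ℕ → F} {C : ℝ} (hc : ∀ n, ‖c n‖ ≤ C) :
    SummableOnUnitBall c := fun r hr₀ hr₁ =>
  Summable.of_nonneg_of_le (fun n => by positivity)
    (fun n => mul_le_mul_of_nonneg_right (hc n) (by positivity))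
    ((summable_geometric_of_lt_one hr₀ hr₁).mul_left C)

variable [NormedSpace ℝ F]

theorem SummableOnUnitBall.succ_smul_shift {c : ℕ → F} (hc : SummableOnUnitBall c) :
    SummableOnUnitBall fun n => (n + 1 : ℝ) • c (n + 1) := fun r hr₀ hr₁ => by
  obtain ⟨s, hrs, hs₁⟩ := exists_between hr₁
  have hs₀ : 0 < s := hr₀.trans_lt hrs
  obtain ⟨C, hC⟩ := (hc s hs₀.le hs₁).tendsto_atTop_zero.bddAbove_range
  have hq : ‖r / s‖ < 1 := by
    rwa [Real.norm_of_nonneg (by positivity), div_lt_one hs₀]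
  have hgeom : Summable fun n : ℕ => ((n : ℝ) + 1) * (r / s) ^ n := by
    simpa only [add_mul, one_mul, pow_one] using
      (summable_pow_mul_geometric_of_norm_lt_one 1 hq).add (summable_geometric_of_norm_lt_one hq)
  refine Summable.of_nonneg_of_le (fun n => by positivity) (fun n => ?_) (hgeom.mul_left (C / s))
  rw [norm_smul, Real.norm_of_nonneg (by positivity)]
  calc (n + 1) * ‖c (n + 1)‖ * r ^ n
      = ‖c (n + 1)‖ * s ^ (n + 1) / s * ((n + 1) * (r / s) ^ n) := by
        rw [div_pow, pow_succ]
        field_simp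
    _ ≤ C / s * ((n + 1) * (r / s) ^ n) := by
        gcongr
        exact hC ⟨n + 1, rfl⟩

variable [CompleteSpace F]

theorem SummableOnUnitBall.hasSum {c : ℕ → F} (hc : SummableOnUnitBall c) {r : ℝ} (hr : |r| < 1) :
    HasSum (fun n => r ^ n • c n) (∑' n : ℕ, r ^ n • c n) :=
  (Summable.of_norm ((hc |r| (abs_nonneg r) hr).congr fun n => by
    rw [norm_smul, norm_pow, Real.norm_eq_abs, mul_comm])).hasSum

theorem SummableOnUnitBall.hasDerivAt_tsum_pow_succ_div_smul {c : ℕ → F}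
    (hc : SummableOnUnitBall c) {r : ℝ} (hr : |r| < 1) :
    HasDerivAt (fun z : ℝ => ∑' n : ℕ, (z ^ (n + 1) / (n + 1)) • c n)
      (∑' n : ℕ, r ^ n • c n) r := by
  obtain ⟨s, hrs, hs₁⟩ := exists_between hr
  refine hasDerivAt_tsum_of_isPreconnected
    (g := fun (n : ℕ) (z : ℝ) => (z ^ (n + 1) / (n + 1)) • c n)
    (g' := fun (n : ℕ) (z : ℝ) => z ^ n • c n) (y₀ := 0)
    (hc s ((abs_nonneg r).trans hrs.le) hs₁) Metric.isOpen_ball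
    (convex_ball (0 : ℝ) s).isPreconnected (fun n z _ => ?_) (fun n z hz => ?_)
    (by simpa using (abs_nonneg r).trans_lt hrs) ?_ (by simpa using hrs)
  · refine (((hasDerivAt_pow (n + 1) z).div_const _).smul_const (c n)).congr_deriv ?_
    push_cast
    rw [mul_div_cancel_left₀ _ (by positivity)]
  · have hzs : |z| < s := by simpa using hz
    rw [norm_smul, norm_pow, Real.norm_eq_abs, mul_comm]
    gcongr
  · simp

theorem SummableOnUnitBall.hasDerivAt_tsum_pow_smul {c : ℕ → F}
    (hc : SummableOnUnitBall c) {r : ℝ} (hr : |r| < 1) :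
    HasDerivAt (fun z : ℝ => ∑' n : ℕ, z ^ n • c n)
      (∑' n : ℕ, r ^ n • (n + 1 : ℝ) • c (n + 1)) r := by
  have hderiv := hc.succ_smul_shift.hasDerivAt_tsum_pow_succ_div_smul hr
  refine (hderiv.const_add (c 0)).congr_of_eventuallyEq ?_
  filter_upwards [Metric.isOpen_ball.mem_nhds (mem_ball_zero_iff.2 hr)] with z hz
  rw [(hc.hasSum (mem_ball_zero_iff.1 hz)).summable.tsum_eq_zero_add, pow_zero, one_smul]
  congr 1
  refine tsum_congr fun n => ?_
  rw [smul_smul, div_mul_cancel₀ _ (by positivity)]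

end PowerSeries

/-! ### The diagonal of the Mehler kernel -/

section Mehler

open Polynomial

/-- The coefficients `Hₙ(x)² / (2ⁿ n!)` of the Mehler kernel on the diagonal. -/
def mehlerCoeff (x : ℝ) (n : ℕ) : ℝ := (hermitePoly n).eval x ^ 2 / (2 ^ n * n.factorial)

theorem mehlerCoeff_nonneg (x : ℝ) (n : ℕ) : 0 ≤ mehlerCoeff x n := by
  unfold mehlerCoeff
  positivity

theorem mehlerCoeff_zero (x : ℝ) : mehlerCoeff x 0 = 1 := by
  simp [mehlerCoeff, hermitePoly]

theorem mehlerCoeff_one (x : ℝ) : mehlerCoeff x 1 = 2 * x ^ 2 := by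
  simp only [mehlerCoeff, hermitePoly]
  norm_num
  ring

theorem mehlerCoeff_two (x : ℝ) : mehlerCoeff x 2 = (2 * x ^ 2 - 1) ^ 2 / 2 := by
  simp only [mehlerCoeff, hermitePoly]
  norm_num [Nat.factorial]
  ring

theorem eval_hermitePoly_succ_succ (x : ℝ) (n : ℕ) :
    (hermitePoly (n + 2)).eval x
      = 2 * x * (hermitePoly (n + 1)).eval x - 2 * (n + 1) * (hermitePoly n).eval x := by
  simp [hermitePoly_succ_succ]

theorem eval_hermitePoly_sq (x : ℝ) (n : ℕ) :
    (hermitePoly n).eval x ^ 2 = 2 ^ n * n.factorial * mehlerCoeff x n := by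
  unfold mehlerCoeff
  field_simp

theorem mehlerCoeff_recurrence (x : ℝ) (n : ℕ) :
    (n + 3) * mehlerCoeff x (n + 3) = (2 * x ^ 2 - n - 2) * mehlerCoeff x (n + 2)
      + (n + 2 - 2 * x ^ 2) * mehlerCoeff x (n + 1) + (n + 1) * mehlerCoeff x n := by
  have hH₂ := eval_hermitePoly_succ_succ x n
  have hH₃ := eval_hermitePoly_succ_succ x (n + 1)
  have hsq₀ := eval_hermitePoly_sq x n
  have hsq₁ := eval_hermitePoly_sq x (n + 1)
  have hsq₂ := eval_hermitePoly_sq x (n + 2)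
  have hsq₃ := eval_hermitePoly_sq x (n + 3)
  simp only [Nat.factorial_succ, pow_succ] at hsq₀ hsq₁ hsq₂ hsq₃
  push_cast at hH₃ hsq₀ hsq₁ hsq₂ hsq₃
  have hne : (2 ^ n * n.factorial : ℝ) * (8 * (n + 1) * (n + 2)) ≠ 0 := by positivity
  refine mul_left_cancel₀ hne ?_
  have hrec : (hermitePoly (n + 3)).eval x ^ 2 / 2
      = (2 * x ^ 2 - n - 2) * (hermitePoly (n + 2)).eval x ^ 2
        + (n + 2 - 2 * x ^ 2) * (2 * (n + 2)) * (hermitePoly (n + 1)).eval x ^ 2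
        + (n + 1) * (4 * (n + 2) * (n + 1)) * (hermitePoly n).eval x ^ 2 := by
    rw [hH₃, hH₂]
    ring
  linear_combination 2 * hrec - hsq₃ + 2 * (2 * x ^ 2 - n - 2) * hsq₂
    + 4 * (n + 2) * (n + 2 - 2 * x ^ 2) * hsq₁ + 8 * (n + 1) * (n + 2) * (n + 1) * hsq₀

theorem sub_sq_le_add_sq_mul {δ : ℝ} (hδ : 0 < δ) (u v : ℝ) :
    (u - v) ^ 2 ≤ (1 + 1 / δ) * u ^ 2 + (1 + δ) * v ^ 2 := by
  have hsq : 0 ≤ (u + δ * v) ^ 2 / δ := by positivity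
  have hexpand : (u + δ * v) ^ 2 / δ = 1 / δ * u ^ 2 + 2 * u * v + δ * v ^ 2 := by
    field_simp
    ring
  linarith

theorem mehlerCoeff_succ_succ_le (x : ℝ) (n : ℕ) {δ : ℝ} (hδ : 0 < δ) :
    mehlerCoeff x (n + 2) ≤ (1 + 1 / δ) * (2 * x ^ 2 / (n + 2)) * mehlerCoeff x (n + 1)
      + (1 + δ) * mehlerCoeff x n := by
  have hnonneg := mehlerCoeff_nonneg x n
  have hratio : ((n : ℝ) + 1) / (n + 2) ≤ 1 := by
    rw [div_le_one (by positivity)]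
    linarith
  calc mehlerCoeff x (n + 2)
      ≤ ((1 + 1 / δ) * (2 * x * (hermitePoly (n + 1)).eval x) ^ 2
          + (1 + δ) * (2 * (n + 1) * (hermitePoly n).eval x) ^ 2)
        / (2 ^ (n + 2) * (n + 2).factorial) := by
        rw [mehlerCoeff, eval_hermitePoly_succ_succ]
        gcongr
        exact sub_sq_le_add_sq_mul hδ _ _
    _ = (1 + 1 / δ) * (2 * x ^ 2 / (n + 2)) * mehlerCoeff x (n + 1)
        + (1 + δ) * ((n + 1) / (n + 2) * mehlerCoeff x n) := by
        simp only [mehlerCoeff, Nat.factorial_succ, pow_succ]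
        push_cast
        field_simp
        ring
    _ ≤ _ := by
        gcongr
        exact mul_le_of_le_one_left hnonneg hratio

theorem eventually_mehlerCoeff_add_le (x : ℝ) {δ : ℝ} (hδ : 0 < δ) :
    ∀ᶠ n in atTop, mehlerCoeff x (n + 1) + mehlerCoeff x (n + 2)
      ≤ (1 + δ) * (mehlerCoeff x n + mehlerCoeff x (n + 1)) := by
  have hlim : Tendsto (fun n : ℕ => (1 + 1 / δ) * (2 * x ^ 2 / ((n : ℝ) + 2))) atTop (𝓝 0) := by
    simpa using ((tendsto_atTop_add_const_right atTop (2 : ℝ)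
      tendsto_natCast_atTop_atTop).const_div_atTop (2 * x ^ 2)).const_mul (1 + 1 / δ)
  filter_upwards [hlim.eventually (gt_mem_nhds hδ)] with n hn
  have hsmall := mul_le_mul_of_nonneg_right hn.le (mehlerCoeff_nonneg x (n + 1))
  linarith [mehlerCoeff_succ_succ_le x n hδ]

theorem summableOnUnitBall_mehlerCoeff (x : ℝ) : SummableOnUnitBall (mehlerCoeff x) := by
  intro r hr₀ hr₁
  obtain ⟨q, hrq, hq₁⟩ := exists_between hr₁
  have hq₀ : 0 < q := hr₀.trans_lt hrq
  have hδ : 0 < q⁻¹ - 1 := sub_pos.2 ((one_lt_inv₀ hq₀).2 hq₁)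
  let S : ℕ → ℝ := fun n => mehlerCoeff x n + mehlerCoeff x (n + 1)
  have hS (n : ℕ) : 0 ≤ S n := add_nonneg (mehlerCoeff_nonneg x n) (mehlerCoeff_nonneg x (n + 1))
  have hsum : Summable fun n => S n * r ^ n := by
    refine summable_of_ratio_norm_eventually_le (r := r / q) (by rwa [div_lt_one hq₀]) ?_
    filter_upwards [eventually_mehlerCoeff_add_le x hδ] with n hn
    rw [add_sub_cancel] at hn
    rw [Real.norm_of_nonneg (mul_nonneg (hS _) (by positivity)),
      Real.norm_of_nonneg (mul_nonneg (hS _) (by positivity)), pow_succ]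
    calc S (n + 1) * (r ^ n * r) ≤ q⁻¹ * S n * (r ^ n * r) := by gcongr
      _ = r / q * (S n * r ^ n) := by ring
  refine Summable.of_nonneg_of_le (fun n => by positivity) (fun n => ?_) hsum
  rw [Real.norm_of_nonneg (mehlerCoeff_nonneg x n)]
  gcongr
  exact le_add_of_nonneg_right (mehlerCoeff_nonneg x (n + 1))

/-- The Mehler kernel `∑ Hₙ(x)² rⁿ / (2ⁿ n!)` on the diagonal. -/
def mehlerSum (x r : ℝ) : ℝ := ∑' n : ℕ, r ^ n * mehlerCoeff x n

theorem hasSum_mehlerSum (x : ℝ) {r : ℝ} (hr : |r| < 1) :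
    HasSum (fun n => r ^ n * mehlerCoeff x n) (mehlerSum x r) :=
  (summableOnUnitBall_mehlerCoeff x).hasSum hr

theorem mehlerSum_zero (x : ℝ) : mehlerSum x 0 = 1 := by
  rw [mehlerSum, tsum_eq_single 0 fun n hn => by rw [zero_pow hn, zero_mul], pow_zero, one_mul,
    mehlerCoeff_zero]

theorem mehlerSum_differential_equation (x : ℝ) {r M' : ℝ} (hr : |r| < 1)
    (hM' : HasSum (fun n : ℕ => r ^ n * ((n + 1) * mehlerCoeff x (n + 1))) M') :
    (1 - r) * (1 + r) ^ 2 * M' = (r * (1 + r) + 2 * x ^ 2 * (1 - r)) * mehlerSum x r := by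
  let d : ℕ → ℝ := fun n => r ^ n * ((n + 1) * mehlerCoeff x (n + 1))
  let m : ℕ → ℝ := fun n => r ^ n * mehlerCoeff x n
  have hM : HasSum m (mehlerSum x r) := hasSum_mehlerSum x hr
  have hleft : HasSum (fun n => d (n + 3) + r * d (n + 2) - r ^ 2 * d (n + 1) - r ^ 3 * d n) _ :=
    ((((hasSum_nat_add_iff' 3).2 hM').add (((hasSum_nat_add_iff' 2).2 hM').mul_left r)).sub
      (((hasSum_nat_add_iff' 1).2 hM').mul_left (r ^ 2))).sub (hM'.mul_left (r ^ 3))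
  have hright : HasSum (fun n => 2 * x ^ 2 * m (n + 3) + (1 - 2 * x ^ 2) * r * m (n + 2)
      + r ^ 2 * m (n + 1)) _ :=
    ((((hasSum_nat_add_iff' 3).2 hM).mul_left (2 * x ^ 2)).add
      (((hasSum_nat_add_iff' 2).2 hM).mul_left ((1 - 2 * x ^ 2) * r))).add
      (((hasSum_nat_add_iff' 1).2 hM).mul_left (r ^ 2))
  have hsums := hleft.unique <| hright.congr_fun fun n => by
    have hrec := mehlerCoeff_recurrence x (n + 1)
    simp only [d, m]
    push_cast at hrec ⊢
    linear_combination r ^ (n + 3) * hrec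
  have hrec := mehlerCoeff_recurrence x 0
  simp only [Finset.sum_range_succ, Finset.sum_range_zero, m] at hsums
  norm_num [mehlerCoeff_zero, mehlerCoeff_one, mehlerCoeff_two] at hsums hrec
  linear_combination hsums + r ^ 2 * hrec

theorem hasDerivAt_mehlerSum (x : ℝ) {r : ℝ} (hr : |r| < 1) :
    HasDerivAt (mehlerSum x) ((r / (1 - r ^ 2) + 2 * x ^ 2 / (1 + r) ^ 2) * mehlerSum x r) r := by
  have hc := summableOnUnitBall_mehlerCoeff x
  have hode := mehlerSum_differential_equation x hr (hc.succ_smul_shift.hasSum hr)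
  simp only [smul_eq_mul] at hode
  obtain ⟨hr₀, hr₁⟩ := abs_lt.1 hr
  have hadd : 1 + r ≠ 0 := by linarith
  have hsub : 1 - r ≠ 0 := by linarith
  have hfactor : 1 - r ^ 2 = (1 - r) * (1 + r) := by ring
  refine (hc.hasDerivAt_tsum_pow_smul hr).congr_deriv ?_
  rw [hfactor]
  simp only [smul_eq_mul]
  generalize ∑' n : ℕ, r ^ n * ((n + 1) * mehlerCoeff x (n + 1)) = M' at hode ⊢
  field_simp
  linear_combination hode

/-- The closed form of the Mehler kernel on the diagonal, the right-hand side of Mehler's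
formula. -/
def mehlerClosedForm (x r : ℝ) : ℝ := Real.exp (2 * x ^ 2 * (r / (1 + r))) / √(1 - r ^ 2)

theorem hasDerivAt_mehlerClosedForm (x : ℝ) {r : ℝ} (hr : |r| < 1) :
    HasDerivAt (mehlerClosedForm x)
      ((r / (1 - r ^ 2) + 2 * x ^ 2 / (1 + r) ^ 2) * mehlerClosedForm x r) r := by
  have hadd : 1 + r ≠ 0 := by linarith [(abs_lt.1 hr).1]
  have hpos : 0 < 1 - r ^ 2 := sub_pos.2 ((sq_lt_one_iff_abs_lt_one r).2 hr)
  have hsqrt : 0 < √(1 - r ^ 2) := Real.sqrt_pos.2 hpos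
  have hexp := (((hasDerivAt_id r).fun_div ((hasDerivAt_id r).const_add 1) hadd).const_mul
    (2 * x ^ 2)).exp
  refine (hexp.div (((hasDerivAt_pow 2 r).const_sub 1).sqrt hpos.ne') hsqrt.ne').congr_deriv ?_
  have hsq : √(1 - r ^ 2) ^ 2 = 1 - r ^ 2 := Real.sq_sqrt hpos.le
  simp only [mehlerClosedForm, id]
  field_simp
  simp only [hsq]
  ring

theorem mehlerSum_eq_mehlerClosedForm (x : ℝ) {r : ℝ} (hr : |r| < 1) :
    mehlerSum x r = mehlerClosedForm x r := by
  have hne (z : ℝ) (hz : |z| < 1) : mehlerClosedForm x z ≠ 0 :=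
    div_ne_zero (Real.exp_ne_zero _)
      (Real.sqrt_pos.2 (sub_pos.2 ((sq_lt_one_iff_abs_lt_one z).2 hz))).ne'
  have hderiv (z : ℝ) (hz : z ∈ Metric.ball (0 : ℝ) 1) :
      HasDerivAt (fun z => mehlerSum x z / mehlerClosedForm x z) 0 z := by
    have hz' : |z| < 1 := mem_ball_zero_iff.1 hz
    refine ((hasDerivAt_mehlerSum x hz').div (hasDerivAt_mehlerClosedForm x hz')
      (hne z hz')).congr_deriv ?_
    ring
  have hconst := Metric.isOpen_ball.is_const_of_deriv_eq_zero (convex_ball (0 : ℝ) 1).isPreconnected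
    (fun z hz => (hderiv z hz).differentiableAt.differentiableWithinAt)
    (fun z hz => (hderiv z hz).deriv) (mem_ball_zero_iff.2 hr) (Metric.mem_ball_self one_pos)
  have hzero : mehlerClosedForm x 0 = 1 := by simp [mehlerClosedForm]
  rw [mehlerSum_zero, hzero, div_one] at hconst
  exact eq_of_div_eq_one hconst

end Mehler

/-! ### Diagonal entries of multiplication operators -/

section MultiplicationDiagonal

open Polynomial

/-- The probability density `hₙ²`, where `hₙ` is the `n`-th Hermite function. -/
def hermiteDensity (n : ℕ) (x : ℝ) : ℝ := mehlerCoeff x n * Real.exp (-x ^ 2) / √Real.pi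

theorem hermiteDensity_nonneg (n : ℕ) (x : ℝ) : 0 ≤ hermiteDensity n x := by
  have := mehlerCoeff_nonneg x n
  unfold hermiteDensity
  positivity

theorem hermiteFun_mul_self (n : ℕ) (x : ℝ) :
    hermiteFun n x * hermiteFun n x = (hermiteDensity n x : ℂ) := by
  rw [hermiteFun, polyGaussian_apply, ← Complex.ofReal_mul, hermiteDensity, mehlerCoeff]
  congr 1
  have hexp : Real.exp (-x ^ 2 / 2) * Real.exp (-x ^ 2 / 2) = Real.exp (-x ^ 2) := by
    rw [← Real.exp_add, add_halves]
  have hne := (hermiteNorm_pos n).ne'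
  calc polyGaussianFun ((hermiteNorm n)⁻¹ • hermitePoly n) x *
        polyGaussianFun ((hermiteNorm n)⁻¹ • hermitePoly n) x
      = (hermitePoly n).eval x ^ 2 / hermiteNorm n ^ 2 *
          (Real.exp (-x ^ 2 / 2) * Real.exp (-x ^ 2 / 2)) := by
        simp only [polyGaussianFun, eval_smul, smul_eq_mul]
        field_simp
    _ = _ := by
        rw [hexp, hermiteNorm_sq]
        field_simp

theorem integrable_hermiteDensity (n : ℕ) : Integrable (hermiteDensity n) := by
  refine (integrable_schwartz_mul (hermiteFun n) (hermiteFun n)).re.congr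
    (Eventually.of_forall fun x => ?_)
  simp only [hermiteFun_mul_self, RCLike.re_to_complex, Complex.ofReal_re]

theorem integral_hermiteDensity (n : ℕ) : ∫ x, hermiteDensity n x = 1 := by
  have hnorm : inner ℂ (schwartzToL2 (hermiteFun n)) (schwartzToL2 (hermiteFun n)) = (1 : ℂ) :=
    inner_self_eq_one_of_norm_eq_one (orthonormal_hermiteFun.norm_eq_one n)
  have hinner : inner ℂ (schwartzToL2 (hermiteFun n)) (schwartzToL2 (hermiteFun n))
      = ∫ x, hermiteFun n x * hermiteFun n x :=
    inner_polyGaussianL2_schwartzToL2 ((hermiteNorm n)⁻¹ • hermitePoly n) (hermiteFun n)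
  simp_rw [hnorm, hermiteFun_mul_self, integral_complex_ofReal] at hinner
  exact_mod_cast hinner.symm

theorem hasSum_hermiteDensity (x : ℝ) {r : ℝ} (hr : |r| < 1) :
    HasSum (fun n => r ^ n * hermiteDensity n x)
      (Real.exp (-((1 - r) / (1 + r)) * x ^ 2) / (√Real.pi * √(1 - r ^ 2))) := by
  have hadd : 1 + r ≠ 0 := by linarith [(abs_lt.1 hr).1]
  have hexponent : -((1 - r) / (1 + r)) * x ^ 2 = 2 * x ^ 2 * (r / (1 + r)) + -x ^ 2 := by
    field_simp
    ring
  have hsum := (hasSum_mehlerSum x hr).mul_right (Real.exp (-x ^ 2) / √Real.pi)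
  rw [mehlerSum_eq_mehlerClosedForm x hr, mehlerClosedForm, div_mul_div_comm, ← Real.exp_add,
    ← hexponent, mul_comm (√(1 - r ^ 2))] at hsum
  exact hsum.congr_fun fun n => by rw [hermiteDensity, mul_div_assoc, mul_assoc]

theorem inner_hermiteBasis_mulOp (f : ℝ →ᵇ ℂ) (n : ℕ) :
    inner ℂ (hermiteBasis n) (mulOp f (hermiteBasis n)) = ∫ x, hermiteDensity n x • f x := by
  rw [hermiteBasis_apply]
  refine (inner_polyGaussianL2 ((hermiteNorm n)⁻¹ • hermitePoly n)
    (mulOp f (schwartzToL2 (hermiteFun n)))).trans (integral_congr_ae ?_)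
  filter_upwards [mulOp_apply_ae f (schwartzToL2 (hermiteFun n)),
    coeFn_schwartzToL2 (hermiteFun n)] with x hmul hcoe
  rw [hmul, hcoe, ← hermiteFun, Complex.real_smul, ← hermiteFun_mul_self]
  ring

theorem norm_hermiteDensity_smul_le (f : ℝ →ᵇ ℂ) (n : ℕ) (x : ℝ) :
    ‖hermiteDensity n x • f x‖ ≤ ‖f‖ * hermiteDensity n x := by
  rw [norm_smul, Real.norm_of_nonneg (hermiteDensity_nonneg n x), mul_comm]
  exact mul_le_mul_of_nonneg_right (f.norm_coe_le_norm x) (hermiteDensity_nonneg n x)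

theorem integrable_hermiteDensity_smul (f : ℝ →ᵇ ℂ) (n : ℕ) :
    Integrable fun x => hermiteDensity n x • f x :=
  ((integrable_hermiteDensity n).const_mul ‖f‖).mono'
    ((integrable_hermiteDensity n).1.smul f.continuous.aestronglyMeasurable)
    (Eventually.of_forall (norm_hermiteDensity_smul_le f n))

theorem integral_norm_pow_smul_hermiteDensity_smul_le (f : ℝ →ᵇ ℂ) (r : ℝ) (n : ℕ) :
    ∫ x, ‖r ^ n • hermiteDensity n x • f x‖ ≤ ‖f‖ * |r| ^ n := by
  have hnorm (x : ℝ) : ‖r ^ n • hermiteDensity n x • f x‖ ≤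
      ‖f‖ * |r| ^ n * hermiteDensity n x := by
    rw [norm_smul, norm_pow, Real.norm_eq_abs, mul_right_comm, mul_comm (|r| ^ n)]
    exact mul_le_mul_of_nonneg_right (norm_hermiteDensity_smul_le f n x) (by positivity)
  calc ∫ x, ‖r ^ n • hermiteDensity n x • f x‖
      ≤ ∫ x, ‖f‖ * |r| ^ n * hermiteDensity n x :=
        integral_mono_of_nonneg (Eventually.of_forall fun x => norm_nonneg _)
          ((integrable_hermiteDensity n).const_mul _) (Eventually.of_forall hnorm)
    _ = ‖f‖ * |r| ^ n := by rw [integral_const_mul, integral_hermiteDensity, mul_one]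

theorem hasSum_pow_smul_inner_hermiteBasis_mulOp (f : ℝ →ᵇ ℂ) {r : ℝ} (hr : |r| < 1) :
    HasSum (fun n => r ^ n • inner ℂ (hermiteBasis n) (mulOp f (hermiteBasis n)))
      ((√Real.pi * √(1 - r ^ 2))⁻¹ •
        ∫ x, Real.exp (-((1 - r) / (1 + r)) * x ^ 2) • f x) := by
  have hsummable : Summable fun n => ∫ x, ‖r ^ n • hermiteDensity n x • f x‖ :=
    Summable.of_nonneg_of_le (fun n => integral_nonneg fun x => norm_nonneg _)
      (integral_norm_pow_smul_hermiteDensity_smul_le f r)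
      ((summable_geometric_of_lt_one (abs_nonneg r) hr).mul_left ‖f‖)
  have hsum := hasSum_integral_of_summable_integral_norm
    (F := fun n x => r ^ n • hermiteDensity n x • f x)
    (fun n => (integrable_hermiteDensity_smul f n).smul (r ^ n)) hsummable
  have htsum (x : ℝ) : ∑' n, r ^ n • hermiteDensity n x • f x
      = (√Real.pi * √(1 - r ^ 2))⁻¹ • Real.exp (-((1 - r) / (1 + r)) * x ^ 2) • f x := by
    simp_rw [smul_smul]
    rw [((hasSum_hermiteDensity x hr).smul_const (f x)).tsum_eq, div_eq_inv_mul]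
  simp_rw [htsum, integral_smul, ← inner_hermiteBasis_mulOp] at hsum
  exact hsum

end MultiplicationDiagonal

/-! ### Gaussian averages -/

section GaussianMean

theorem integrable_exp_neg_sq : Integrable fun y : ℝ => Real.exp (-y ^ 2) := by
  simpa using integrable_exp_neg_mul_sq (b := 1) one_pos

theorem integrable_two_mul_sq_mul_exp_neg_sq :
    Integrable fun y : ℝ => 2 * y ^ 2 * Real.exp (-y ^ 2) := by
  have hmoment := (integrable_rpow_mul_exp_neg_mul_sq (b := 1) one_pos (s := 2)
    (by norm_num)).const_mul 2
  refine hmoment.congr (Eventually.of_forall fun y => ?_)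
  simp only [Real.rpow_two, neg_mul, one_mul]
  ring

variable {F : Type*} [NormedAddCommGroup F] [NormedSpace ℝ F]

theorem norm_two_mul_mul_exp_neg_sq_smul_le {C y : ℝ} {v : F} (hv : ‖v‖ ≤ C * |y|) :
    ‖(2 * y * Real.exp (-y ^ 2)) • v‖ ≤ C * (2 * y ^ 2 * Real.exp (-y ^ 2)) := by
  rw [norm_smul, norm_mul, norm_mul, Real.norm_of_nonneg (Real.exp_pos _).le, Real.norm_eq_abs,
    Real.norm_eq_abs, abs_two]
  calc 2 * |y| * Real.exp (-y ^ 2) * ‖v‖ ≤ 2 * |y| * Real.exp (-y ^ 2) * (C * |y|) := by gcongr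
    _ = C * (2 * |y| ^ 2 * Real.exp (-y ^ 2)) := by ring
    _ = C * (2 * y ^ 2 * Real.exp (-y ^ 2)) := by rw [sq_abs]

theorem integrable_exp_neg_sq_smul_of_norm_le {v : ℝ → F} (hv : Continuous v) {C : ℝ}
    (hbound : ∀ y, ‖v y‖ ≤ C * (1 + 2 * y ^ 2)) :
    Integrable fun y => Real.exp (-y ^ 2) • v y := by
  refine ((integrable_exp_neg_sq.add integrable_two_mul_sq_mul_exp_neg_sq).const_mul C).mono'
    (Continuous.aestronglyMeasurable (by fun_prop)) (Eventually.of_forall fun y => ?_)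
  rw [norm_smul, Real.norm_of_nonneg (Real.exp_pos _).le, Pi.add_apply]
  calc Real.exp (-y ^ 2) * ‖v y‖ ≤ Real.exp (-y ^ 2) * (C * (1 + 2 * y ^ 2)) := by
        gcongr
        exact hbound y
    _ = C * (Real.exp (-y ^ 2) + 2 * y ^ 2 * Real.exp (-y ^ 2)) := by ring

theorem integral_exp_neg_sq_smul_deriv {v v' : ℝ → F} (hv : ∀ y, HasDerivAt v (v' y) y)
    (hv' : Continuous v') {C : ℝ} (hv'C : ∀ y, ‖v' y‖ ≤ C) (hvC : ∀ y, ‖v y‖ ≤ C * |y|) :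
    ∫ y : ℝ, Real.exp (-y ^ 2) • v' y = ∫ y : ℝ, (2 * y * Real.exp (-y ^ 2)) • v y := by
  have hC : 0 ≤ C := (norm_nonneg _).trans (hv'C 0)
  have hvcont : Continuous v := continuous_iff_continuousAt.2 fun y => (hv y).continuousAt
  have hexp (y : ℝ) :
      HasDerivAt (fun y : ℝ => Real.exp (-y ^ 2)) (-(2 * y * Real.exp (-y ^ 2))) y := by
    refine (hasDerivAt_pow 2 y).fun_neg.exp.congr_deriv ?_
    push_cast
    ring
  have hright : Integrable fun y => Real.exp (-y ^ 2) • v' y :=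
    integrable_exp_neg_sq_smul_of_norm_le hv' fun y =>
      (hv'C y).trans (le_mul_of_one_le_right hC (by nlinarith))
  have hleft : Integrable fun y => -(2 * y * Real.exp (-y ^ 2)) • v y := by
    refine (integrable_two_mul_sq_mul_exp_neg_sq.const_mul C).mono'
      (Continuous.aestronglyMeasurable (by fun_prop)) (Eventually.of_forall fun y => ?_)
    rw [neg_smul, norm_neg]
    exact norm_two_mul_mul_exp_neg_sq_smul_le (hvC y)
  have hprod : Integrable fun y => Real.exp (-y ^ 2) • v y :=
    integrable_exp_neg_sq_smul_of_norm_le hvcont fun y => (hvC y).trans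
      (mul_le_mul_of_nonneg_left (by nlinarith [sq_nonneg (|y| - 1), sq_abs y]) hC)
  have hparts := integral_bilinear_hasDerivAt_right_eq_neg_left_of_integrable
    (L := ContinuousLinearMap.lsmul ℝ ℝ) (fun y _ => hexp y) (fun y _ => hv y) hright hleft hprod
  simpa only [ContinuousLinearMap.lsmul_apply, neg_smul, integral_neg, neg_neg] using hparts

theorem integral_two_mul_sq_mul_exp_neg_sq :
    ∫ y : ℝ, 2 * y ^ 2 * Real.exp (-y ^ 2) = √Real.pi := by
  have hparts := integral_exp_neg_sq_smul_deriv hasDerivAt_id continuous_const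
    (C := 1) (fun _y => by simp) (fun y => by simp)
  have hgauss : ∫ y : ℝ, Real.exp (-y ^ 2) = √Real.pi := by simpa using integral_gaussian 1
  simp only [smul_eq_mul, mul_one, id, hgauss] at hparts
  rw [hparts]
  congr 1 with y
  ring

theorem norm_inv_smul_comp_mul_le {P : ℝ → F} {C : ℝ} (hP : ∀ x, ‖P x‖ ≤ C * |x|) {t : ℝ}
    (ht : 0 < t) (y : ℝ) : ‖t⁻¹ • P (t * y)‖ ≤ C * |y| := by
  rw [norm_smul, Real.norm_of_nonneg (inv_nonneg.2 ht.le), inv_mul_le_iff₀ ht]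
  calc ‖P (t * y)‖ ≤ C * |t * y| := hP _
    _ = t * (C * |y|) := by rw [abs_mul, abs_of_pos ht, mul_left_comm]

variable [CompleteSpace F]

theorem integral_two_mul_sq_mul_exp_neg_sq_smul_ite (p q : F) :
    ∫ y : ℝ, (2 * y ^ 2 * Real.exp (-y ^ 2)) • (if 0 < y then p else q)
      = (√Real.pi / 2) • (p + q) := by
  let h (y : ℝ) : F := (2 * y ^ 2 * Real.exp (-y ^ 2)) • (if 0 < y then p else q)
  have hint : Integrable h := by
    refine (integrable_two_mul_sq_mul_exp_neg_sq.mul_const (max ‖p‖ ‖q‖)).mono' ?_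
      (Eventually.of_forall fun y => ?_)
    · exact (Continuous.aestronglyMeasurable (by fun_prop)).smul (StronglyMeasurable.ite
        measurableSet_Ioi stronglyMeasurable_const stronglyMeasurable_const).aestronglyMeasurable
    · rw [norm_smul, Real.norm_of_nonneg (by positivity)]
      gcongr
      split_ifs
      exacts [le_max_left _ _, le_max_right _ _]
  have hsymm (y : ℝ) (hy : y ≠ 0) :
      h y + h (-y) = (2 * y ^ 2 * Real.exp (-y ^ 2)) • (p + q) := by
    simp only [h, neg_sq, ← smul_add]
    rcases hy.lt_or_gt with hy | hy
    · rw [if_neg hy.not_gt, if_pos (neg_pos.2 hy), add_comm]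
    · rw [if_pos hy, if_neg (by linarith)]
  have hdouble : (2 : ℝ) • ∫ y, h y = √Real.pi • (p + q) := by
    rw [← integral_two_mul_sq_mul_exp_neg_sq, ← integral_smul_const, two_smul]
    nth_rewrite 2 [← integral_neg_eq_self h volume]
    rw [← integral_add hint hint.comp_neg]
    exact integral_congr_ae ((Measure.ae_ne volume 0).mono hsymm)
  rw [div_eq_inv_mul, mul_smul, ← hdouble, inv_smul_smul₀ two_ne_zero]

theorem tendsto_integral_smul_inv_smul_comp_mul {P : ℝ → F} (hP : Continuous P) {C : ℝ}
    (hPC : ∀ x, ‖P x‖ ≤ C * |x|) {p q : F} (hp : Tendsto (fun x => x⁻¹ • P x) atTop (𝓝 p))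
    (hq : Tendsto (fun x => x⁻¹ • P x) atBot (𝓝 q)) :
    Tendsto (fun t : ℝ => ∫ y : ℝ, (2 * y * Real.exp (-y ^ 2)) • t⁻¹ • P (t * y)) atTop
      (𝓝 ((√Real.pi / 2) • (p + q))) := by
  rw [← integral_two_mul_sq_mul_exp_neg_sq_smul_ite]
  refine tendsto_integral_filter_of_dominated_convergence
    (fun y => C * (2 * y ^ 2 * Real.exp (-y ^ 2)))
    (Eventually.of_forall fun t => Continuous.aestronglyMeasurable (by fun_prop)) ?_
    (integrable_two_mul_sq_mul_exp_neg_sq.const_mul _) (Eventually.of_forall fun y => ?_)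
  · filter_upwards [eventually_gt_atTop 0] with t ht
    refine Eventually.of_forall fun y => norm_two_mul_mul_exp_neg_sq_smul_le ?_
    exact norm_inv_smul_comp_mul_le hPC ht y
  · have hlim {c : F} (hc : Tendsto (fun t : ℝ => (t * y)⁻¹ • P (t * y)) atTop (𝓝 c))
        (hy : y ≠ 0) : Tendsto (fun t : ℝ => (2 * y * Real.exp (-y ^ 2)) • t⁻¹ • P (t * y)) atTop
          (𝓝 ((2 * y ^ 2 * Real.exp (-y ^ 2)) • c)) := by
      refine (hc.const_smul (2 * y ^ 2 * Real.exp (-y ^ 2))).congr fun t => ?_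
      rw [smul_smul, smul_smul]
      congr 1
      field_simp
    rcases lt_trichotomy y 0 with hy | rfl | hy
    · rw [if_neg hy.not_gt]
      exact hlim (hq.comp (tendsto_id.atTop_mul_const_of_neg hy)) hy.ne
    · simp
    · rw [if_pos hy]
      exact hlim (hp.comp (tendsto_id.atTop_mul_const hy)) hy.ne'

theorem tendsto_integral_exp_neg_sq_smul_comp_mul (f : ℝ →ᵇ F) {p q : F}
    (hp : Tendsto (fun x : ℝ => x⁻¹ • ∫ u in (0 : ℝ)..x, f u) atTop (𝓝 p))
    (hq : Tendsto (fun x : ℝ => x⁻¹ • ∫ u in (0 : ℝ)..x, f u) atBot (𝓝 q)) :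
    Tendsto (fun t : ℝ => ∫ y : ℝ, Real.exp (-y ^ 2) • f (t * y)) atTop
      (𝓝 ((√Real.pi / 2) • (p + q))) := by
  let P (x : ℝ) : F := ∫ u in (0 : ℝ)..x, f u
  have hderiv (x : ℝ) : HasDerivAt P (f x) x :=
    (f.continuous.integral_hasStrictDerivAt 0 x).hasDerivAt
  have hP : Continuous P := continuous_iff_continuousAt.2 fun x => (hderiv x).continuousAt
  have hbound (x : ℝ) : ‖P x‖ ≤ ‖f‖ * |x| := by
    simpa using intervalIntegral.norm_integral_le_of_norm_le_const (a := 0) (b := x)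
      fun u _ => f.norm_coe_le_norm u
  refine (tendsto_integral_smul_inv_smul_comp_mul hP hbound hp hq).congr' ?_
  filter_upwards [eventually_gt_atTop 0] with t ht
  refine (integral_exp_neg_sq_smul_deriv (fun y => ?_) (by fun_prop)
    (fun y => f.norm_coe_le_norm _) (norm_inv_smul_comp_mul_le hbound ht)).symm
  refine ((hderiv (t * y)).scomp y ((hasDerivAt_id y).const_mul t)
    |>.const_smul t⁻¹).congr_deriv ?_
  rw [mul_one, inv_smul_smul₀ ht.ne']

theorem tendsto_sqrt_smul_integral_exp_neg_mul_sq_smul (f : ℝ →ᵇ F) {p q : F}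
    (hp : Tendsto (fun x : ℝ => x⁻¹ • ∫ u in (0 : ℝ)..x, f u) atTop (𝓝 p))
    (hq : Tendsto (fun x : ℝ => x⁻¹ • ∫ u in (0 : ℝ)..x, f u) atBot (𝓝 q)) :
    Tendsto (fun s : ℝ => √s • ∫ x : ℝ, Real.exp (-s * x ^ 2) • f x) (𝓝[>] 0)
      (𝓝 ((√Real.pi / 2) • (p + q))) := by
  have hsqrt : Tendsto (fun s : ℝ => √s) (𝓝[>] 0) (𝓝[>] 0) := by
    have hzero := Real.continuous_sqrt.tendsto 0
    rw [Real.sqrt_zero] at hzero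
    exact tendsto_nhdsWithin_iff.2 ⟨hzero.mono_left nhdsWithin_le_nhds,
      eventually_mem_nhdsWithin.mono fun _ hs => Real.sqrt_pos.2 hs⟩
  refine ((tendsto_integral_exp_neg_sq_smul_comp_mul f hp hq).comp
    (tendsto_inv_nhdsGT_zero.comp hsqrt)).congr' ?_
  filter_upwards [self_mem_nhdsWithin] with s (hs : 0 < s)
  have hscale := Measure.integral_comp_mul_left (fun x : ℝ => Real.exp (-s * x ^ 2) • f x) (√s)⁻¹
  rw [inv_inv, abs_of_nonneg (Real.sqrt_nonneg s)] at hscale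
  rw [← hscale]
  simp only [Function.comp_apply, mul_pow, inv_pow, Real.sq_sqrt hs.le, neg_mul,
    mul_inv_cancel_left₀ hs.ne']

end GaussianMean

/-! ### From Abel means to logarithmic means -/

section AbelMeans

theorem tendsto_neg_log_one_sub_nhdsLT_one :
    Tendsto (fun x : ℝ => -Real.log (1 - x)) (𝓝[<] 1) atTop := by
  have hsub : Tendsto (fun x : ℝ => 1 - x) (𝓝[<] 1) (𝓝[>] 0) := by
    refine tendsto_nhdsWithin_iff.2 ⟨?_, ?_⟩
    · have hcont : Continuous fun x : ℝ => 1 - x := by fun_prop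
      simpa only [sub_self] using (hcont.tendsto 1).mono_left nhdsWithin_le_nhds
    · filter_upwards [self_mem_nhdsWithin] with x (hx : x < 1)
      exact sub_pos.2 hx
  exact tendsto_neg_atBot_atTop.comp (Real.tendsto_log_nhdsGT_zero.comp hsub)

theorem tendsto_one_sub_inv_natCast_add_two :
    Tendsto (fun n : ℕ => 1 - ((n : ℝ) + 2)⁻¹) atTop (𝓝[<] 1) := by
  have hinv : Tendsto (fun n : ℕ => ((n : ℝ) + 2)⁻¹) atTop (𝓝 0) :=
    tendsto_inv_atTop_zero.comp
      (tendsto_atTop_add_const_right _ _ tendsto_natCast_atTop_atTop)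
  refine tendsto_nhdsWithin_iff.2 ⟨by simpa only [sub_zero] using hinv.const_sub 1,
    Eventually.of_forall fun n => Set.mem_Iio.2 (sub_lt_self _ (by positivity))⟩

variable {F : Type*} [NormedAddCommGroup F]

theorem isLittleO_log_natCast_add_two_of_isBigO_const {u : ℕ → F} {c : ℝ}
    (hu : u =O[atTop] fun _ => c) : u =o[atTop] fun n : ℕ => Real.log (n + 2) :=
  hu.trans_isLittleO ((Asymptotics.isLittleO_const_left (c := c)).2
    (Or.inr (tendsto_norm_atTop_atTop.comp tendsto_log_natCast_add_two)))

variable [NormedSpace ℝ F]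

theorem norm_sum_one_sub_pow_div_smul_le {b : ℕ → F} {C : ℝ} (hb : ∀ n, ‖b n‖ ≤ C) {r : ℝ}
    (hr₀ : 0 ≤ r) (hr₁ : r ≤ 1) (n : ℕ) :
    ‖∑ k ∈ Finset.range n, ((1 - r ^ (k + 1)) / (k + 1)) • b k‖ ≤ n * (1 - r) * C := by
  have hcoeff (k : ℕ) : (1 - r ^ (k + 1)) / (k + 1) ≤ 1 - r := by
    have bernoulli := one_add_mul_le_pow (a := r - 1) (by linarith) (k + 1)
    rw [add_sub_cancel] at bernoulli
    push_cast at bernoulli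
    rw [div_le_iff₀ (by positivity)]
    linarith
  calc ‖∑ k ∈ Finset.range n, ((1 - r ^ (k + 1)) / (k + 1)) • b k‖
      ≤ ∑ _k ∈ Finset.range n, (1 - r) * C := norm_sum_le_of_le _ fun k _ => by
        have : 0 ≤ 1 - r ^ (k + 1) := sub_nonneg.2 (pow_le_one₀ hr₀ hr₁)
        rw [norm_smul, Real.norm_of_nonneg (by positivity)]
        exact mul_le_mul (hcoeff k) (hb k) (norm_nonneg _) (sub_nonneg.2 hr₁)
    _ = n * (1 - r) * C := by
        rw [Finset.sum_const, Finset.card_range, nsmul_eq_mul, mul_assoc]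

theorem norm_tsum_pow_succ_div_smul_nat_add_le {b : ℕ → F} {C : ℝ} (hb : ∀ n, ‖b n‖ ≤ C) {r : ℝ}
    (hr₀ : 0 ≤ r) (hr₁ : r < 1) (n : ℕ) :
    ‖∑' j : ℕ, (r ^ (j + n + 1) / ((j + n : ℕ) + 1)) • b (j + n)‖ ≤ C / ((n + 1) * (1 - r)) := by
  have : 0 ≤ C := (norm_nonneg _).trans (hb 0)
  have hterm (j : ℕ) :
      ‖(r ^ (j + n + 1) / ((j + n : ℕ) + 1)) • b (j + n)‖ ≤ C / (n + 1) * r ^ j := by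
    rw [norm_smul, Real.norm_of_nonneg (by positivity)]
    calc r ^ (j + n + 1) / ((j + n : ℕ) + 1) * ‖b (j + n)‖ ≤ r ^ j / (n + 1) * C := by
          gcongr ?_ / ?_ * ?_
          · exact pow_le_pow_of_le_one hr₀ hr₁.le (by omega)
          · push_cast
            linarith [j.cast_nonneg (α := ℝ)]
          · exact hb _
      _ = C / (n + 1) * r ^ j := by ring
  refine (tsum_of_norm_bounded ((hasSum_geometric_of_lt_one hr₀ hr₁).mul_left _) hterm).trans_eq ?_
  rw [← div_eq_mul_inv, div_div]

theorem norm_le_add_mul_log_of_hasDerivAt {B G : ℝ → F} {a r ε : ℝ} (har : a ≤ r) (hr : r < 1)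
    (hB : ∀ x ∈ Set.Icc a r, HasDerivAt B (G x) x)
    (hG : ∀ x ∈ Set.Ico a r, ‖(1 - x) • G x‖ ≤ ε) :
    ‖B r‖ ≤ ‖B a‖ + ε * (Real.log (1 - a) - Real.log (1 - r)) := by
  have hlog (x : ℝ) (hx : x ∈ Set.Icc a r) : HasDerivAt
      (fun x => ‖B a‖ + ε * (Real.log (1 - a) - Real.log (1 - x))) (ε / (1 - x)) x := by
    have hx₁ : 1 - x ≠ 0 := (sub_pos.2 (hx.2.trans_lt hr)).ne'
    refine (((((hasDerivAt_id x).const_sub 1).log hx₁).const_sub (Real.log (1 - a))).const_mul ε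
      |>.const_add ‖B a‖).congr_deriv ?_
    rw [neg_div, neg_neg, mul_one_div]
    rfl
  refine image_norm_le_of_norm_deriv_right_le_deriv_boundary'
    (fun x hx => (hB x hx).continuousAt.continuousWithinAt)
    (fun x hx => (hB x (Set.Ico_subset_Icc_self hx)).hasDerivWithinAt) (by simp)
    (fun x hx => (hlog x hx).continuousAt.continuousWithinAt)
    (fun x hx => (hlog x (Set.Ico_subset_Icc_self hx)).hasDerivWithinAt)
    (fun x hx => ?_) (Set.right_mem_Icc.2 har)
  have hx₁ : 0 < 1 - x := sub_pos.2 (hx.2.trans hr)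
  rw [le_div_iff₀' hx₁, ← Real.norm_of_nonneg hx₁.le, ← norm_smul]
  exact hG x hx

theorem isLittleO_log_one_sub_of_hasDerivAt {B G : ℝ → F}
    (hB : ∀ᶠ x in 𝓝[<] 1, HasDerivAt B (G x) x)
    (hG : Tendsto (fun x : ℝ => (1 - x) • G x) (𝓝[<] 1) (𝓝 0)) :
    B =o[𝓝[<] 1] fun x : ℝ => Real.log (1 - x) := by
  refine Asymptotics.isLittleO_iff.2 fun ε hε => ?_
  have hsmall : ∀ᶠ x : ℝ in 𝓝[<] 1, ‖(1 - x) • G x‖ < ε / 2 :=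
    NormedAddGroup.tendsto_nhds_zero.1 hG _ (half_pos hε)
  obtain ⟨l, hl₁ : l < 1, hl⟩ := mem_nhdsLT_iff_exists_Ioo_subset.1 (hB.and hsmall)
  obtain ⟨a, hla, ha₁⟩ := exists_between hl₁
  filter_upwards [Ico_mem_nhdsLT ha₁, tendsto_neg_log_one_sub_nhdsLT_one.eventually_ge_atTop
    ((‖B a‖ + ε / 2 * Real.log (1 - a)) / (ε / 2))] with r hr hlarge
  have hgrowth := norm_le_add_mul_log_of_hasDerivAt hr.1 hr.2
    (fun x hx => (hl ⟨hla.trans_le hx.1, hx.2.trans_lt hr.2⟩).1)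
    (fun x hx => (hl ⟨hla.trans_le hx.1, hx.2.trans hr.2⟩).2.le)
  rw [div_le_iff₀ (half_pos hε)] at hlarge
  have habs := mul_le_mul_of_nonneg_left (neg_le_abs (Real.log (1 - r))) hε.le
  rw [Real.norm_eq_abs]
  linarith

theorem norm_sum_inv_sub_inv_smul_le {a : ℕ → F} {C : ℝ} (ha : ∀ n, ‖a n‖ ≤ C) (n : ℕ) :
    ‖∑ k ∈ Finset.range n, ((2 * k + 1 : ℝ)⁻¹ - (2 * (k + 1) : ℝ)⁻¹) • a k‖ ≤ C := by
  have hC : 0 ≤ C := (norm_nonneg _).trans (ha 0)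
  have hcoeff (k : ℕ) : |(2 * k + 1 : ℝ)⁻¹ - (2 * (k + 1) : ℝ)⁻¹| ≤
      ((k : ℝ) + 1)⁻¹ - ((k + 1 : ℕ) + 1 : ℝ)⁻¹ := by
    have : (0 : ℝ) ≤ k := k.cast_nonneg
    rw [inv_sub_inv (by positivity) (by positivity), inv_sub_inv (by positivity) (by positivity),
      abs_of_nonneg (div_nonneg (by linarith) (by positivity)),
      div_le_div_iff₀ (by positivity) (by positivity)]
    push_cast
    nlinarith
  calc ‖∑ k ∈ Finset.range n, ((2 * k + 1 : ℝ)⁻¹ - (2 * (k + 1) : ℝ)⁻¹) • a k‖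
      ≤ ∑ k ∈ Finset.range n, (((k : ℝ) + 1)⁻¹ - ((k + 1 : ℕ) + 1 : ℝ)⁻¹) * C :=
        norm_sum_le_of_le _ fun k _ => by
          rw [norm_smul]
          exact mul_le_mul (hcoeff k) (ha k) (norm_nonneg _) ((abs_nonneg _).trans (hcoeff k))
    _ = (1 - ((n : ℝ) + 1)⁻¹) * C := by
        rw [← Finset.sum_mul, Finset.sum_range_sub' fun k : ℕ => ((k : ℝ) + 1)⁻¹]
        simp
    _ ≤ C := mul_le_of_le_one_left hC (sub_le_self _ (by positivity))

variable [CompleteSpace F]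

theorem norm_sum_inv_smul_sub_tsum_pow_succ_div_smul_le {b : ℕ → F} {C : ℝ}
    (hb : ∀ n, ‖b n‖ ≤ C) {r : ℝ} (hr₀ : 0 ≤ r) (hr₁ : r < 1) (n : ℕ) :
    ‖∑ k ∈ Finset.range n, (k + 1 : ℝ)⁻¹ • b k - ∑' j : ℕ, (r ^ (j + 1) / (j + 1)) • b j‖
      ≤ n * (1 - r) * C + C / ((n + 1) * (1 - r)) := by
  have hsummable : Summable fun j : ℕ => (r ^ (j + 1) / (j + 1)) • b j := by
    refine Summable.of_norm_bounded ((summable_geometric_of_lt_one hr₀ hr₁).mul_right C)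
      fun j => ?_
    rw [norm_smul, Real.norm_of_nonneg (by positivity)]
    gcongr
    · exact (div_le_self (by positivity) (by linarith [j.cast_nonneg (α := ℝ)])).trans
        (pow_le_pow_of_le_one hr₀ hr₁.le j.le_succ)
    · exact hb j
  have hhead : ∑ k ∈ Finset.range n, (k + 1 : ℝ)⁻¹ • b k
      - ∑ k ∈ Finset.range n, (r ^ (k + 1) / (k + 1)) • b k
      = ∑ k ∈ Finset.range n, ((1 - r ^ (k + 1)) / (k + 1)) • b k := by
    simp only [← Finset.sum_sub_distrib, ← sub_smul, sub_div, one_div]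
  rw [← hsummable.sum_add_tsum_nat_add n, ← sub_sub, hhead]
  exact (norm_sub_le _ _).trans (add_le_add (norm_sum_one_sub_pow_div_smul_le hb hr₀ hr₁.le n)
    (norm_tsum_pow_succ_div_smul_nat_add_le hb hr₀ hr₁ n))

theorem norm_sum_inv_smul_sub_tsum_pow_succ_div_smul_le_two_mul {b : ℕ → F} {C : ℝ}
    (hb : ∀ n, ‖b n‖ ≤ C) (n : ℕ) :
    ‖∑ k ∈ Finset.range (n + 1), (k + 1 : ℝ)⁻¹ • b k
      - ∑' j : ℕ, ((1 - ((n : ℝ) + 2)⁻¹) ^ (j + 1) / (j + 1)) • b j‖ ≤ 2 * C := by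
  have hC : 0 ≤ C := (norm_nonneg _).trans (hb 0)
  have hn : (1 : ℝ) ≤ n + 2 := by linarith [n.cast_nonneg (α := ℝ)]
  have hhead : ((n + 1 : ℕ) : ℝ) * (1 - (1 - ((n : ℝ) + 2)⁻¹)) ≤ 1 := by
    rw [sub_sub_cancel, ← div_eq_mul_inv, div_le_one (by positivity)]
    push_cast
    linarith
  have htail : (((n + 1 : ℕ) : ℝ) + 1) * (1 - (1 - ((n : ℝ) + 2)⁻¹)) = 1 := by
    push_cast
    field_simp
    ring
  refine (norm_sum_inv_smul_sub_tsum_pow_succ_div_smul_le hb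
    (sub_nonneg.2 (inv_le_one_of_one_le₀ hn)) (sub_lt_self _ (by positivity)) (n + 1)).trans ?_
  rw [htail, div_one]
  linarith [mul_le_of_le_one_left hC hhead]

theorem isLittleO_sum_inv_smul_of_tendsto_abel {b : ℕ → F} {C : ℝ} (hb : ∀ n, ‖b n‖ ≤ C)
    (habel : Tendsto (fun r : ℝ => (1 - r) • ∑' n : ℕ, r ^ n • b n) (𝓝[<] 1) (𝓝 0)) :
    (fun n : ℕ => ∑ k ∈ Finset.range (n + 1), (k + 1 : ℝ)⁻¹ • b k)
      =o[atTop] fun n : ℕ => Real.log (n + 2) := by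
  let B (r : ℝ) : F := ∑' j : ℕ, (r ^ (j + 1) / (j + 1)) • b j
  have hderiv : ∀ᶠ r : ℝ in 𝓝[<] 1, HasDerivAt B (∑' n : ℕ, r ^ n • b n) r := by
    filter_upwards [Ioo_mem_nhdsLT (zero_lt_one' ℝ)] with r hr
    exact (summableOnUnitBall_of_norm_le hb).hasDerivAt_tsum_pow_succ_div_smul
      (by rw [abs_of_pos hr.1]; exact hr.2)
  have hB : (fun n : ℕ => B (1 - ((n : ℝ) + 2)⁻¹)) =o[atTop] fun n : ℕ => Real.log (n + 2) := by
    have hcomp := (isLittleO_log_one_sub_of_hasDerivAt hderiv habel).comp_tendsto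
      tendsto_one_sub_inv_natCast_add_two
    simpa only [Function.comp_def, sub_sub_cancel, Real.log_inv,
      Asymptotics.isLittleO_neg_right] using hcomp
  have hdiff := isLittleO_log_natCast_add_two_of_isBigO_const (Asymptotics.IsBigO.of_norm_le
    (norm_sum_inv_smul_sub_tsum_pow_succ_div_smul_le_two_mul hb))
  simpa only [B, sub_add_cancel] using hdiff.add hB

theorem tendsto_abel_sub_const {a : ℕ → F} {C : ℝ} (ha : ∀ n, ‖a n‖ ≤ C) {m : F}
    (habel : Tendsto (fun r : ℝ => (1 - r) • ∑' n : ℕ, r ^ n • a n) (𝓝[<] 1) (𝓝 m)) :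
    Tendsto (fun r : ℝ => (1 - r) • ∑' n : ℕ, r ^ n • (a n - m)) (𝓝[<] 1) (𝓝 0) := by
  rw [← sub_self m]
  refine (habel.sub_const m).congr' ?_
  filter_upwards [Ioo_mem_nhdsLT (zero_lt_one' ℝ)] with r hr
  have hgeom := (hasSum_geometric_of_lt_one hr.1.le hr.2).smul_const m
  have hsum := (summableOnUnitBall_of_norm_le ha).hasSum (r := r)
    (by rw [abs_of_pos hr.1]; exact hr.2)
  simp only [smul_sub]
  rw [(hsum.sub hgeom).tsum_eq, smul_sub, smul_inv_smul₀ (sub_pos.2 hr.2).ne']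

theorem isLittleO_sum_odd_inv_smul_sub_of_tendsto_abel {a : ℕ → F} {C : ℝ}
    (ha : ∀ n, ‖a n‖ ≤ C) {m : F}
    (habel : Tendsto (fun r : ℝ => (1 - r) • ∑' n : ℕ, r ^ n • a n) (𝓝[<] 1) (𝓝 m)) :
    (fun n : ℕ => ∑ k ∈ Finset.range (n + 1), (2 * k + 1 : ℝ)⁻¹ • a k
      - Real.log (n + 2) • (2⁻¹ : ℝ) • m) =o[atTop] fun n : ℕ => Real.log (n + 2) := by
  have hmean := isLittleO_sum_inv_smul_of_tendsto_abel
    (fun n => (norm_sub_le _ _).trans (add_le_add_left (ha n) ‖m‖))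
    (tendsto_abel_sub_const ha habel)
  have hodd := isLittleO_log_natCast_add_two_of_isBigO_const (Asymptotics.IsBigO.of_norm_le
    fun n => norm_sum_inv_sub_inv_smul_le ha (n + 1))
  have hharmonic : (fun n : ℕ => ((harmonic (n + 1) : ℝ) - Real.log (n + 2)) • (2⁻¹ : ℝ) • m)
      =o[atTop] fun n : ℕ => Real.log (n + 2) := by
    have hlim := (Real.tendsto_harmonic_sub_log_add_one.comp (tendsto_add_atTop_nat 1)).smul_const
      ((2⁻¹ : ℝ) • m)
    refine isLittleO_log_natCast_add_two_of_isBigO_const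
      ((hlim.isBigO_one ℝ).congr_left fun n => ?_)
    rw [Function.comp_apply, Nat.cast_succ, add_assoc, one_add_one_eq_two]
  refine ((hodd.add (hmean.const_smul_left (2⁻¹ : ℝ))).add hharmonic).congr_left fun n => ?_
  have hcast : (harmonic (n + 1) : ℝ) = ∑ k ∈ Finset.range (n + 1), (k + 1 : ℝ)⁻¹ := by
    simp [harmonic]
  simp only [Pi.smul_apply, sub_smul, smul_sub, Finset.sum_sub_distrib, hcast, Finset.smul_sum,
    Finset.sum_smul, mul_inv, mul_smul, smul_comm (2⁻¹ : ℝ) _ m]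
  abel

theorem tendsto_inv_log_smul_sum_odd_inv_smul_of_tendsto_abel {a : ℕ → F} {C : ℝ}
    (ha : ∀ n, ‖a n‖ ≤ C) {m : F}
    (habel : Tendsto (fun r : ℝ => (1 - r) • ∑' n : ℕ, r ^ n • a n) (𝓝[<] 1) (𝓝 m)) :
    Tendsto (fun n : ℕ => (Real.log (n + 2))⁻¹ •
      ∑ k ∈ Finset.range (n + 1), (2 * k + 1 : ℝ)⁻¹ • a k) atTop (𝓝 ((2⁻¹ : ℝ) • m)) := by
  have hlim := (isLittleO_sum_odd_inv_smul_sub_of_tendsto_abel ha habel).tendsto_inv_smul_nhds_zero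
    |>.add_const ((2⁻¹ : ℝ) • m)
  rw [zero_add] at hlim
  refine hlim.congr fun n => ?_
  rw [smul_sub, inv_smul_smul₀ (log_natCast_add_two_pos n).ne', sub_add_cancel]

end AbelMeans

/-! ### Multiplication operators against the inverse oscillator -/

section MultiplicationMean

theorem tendsto_abel_inner_hermiteBasis_mulOp (f : ℝ →ᵇ ℂ) {m : ℂ} (hm : HasAsymptoticMean f m) :
    Tendsto (fun r : ℝ => (1 - r) • ∑' n : ℕ, r ^ n •
      inner ℂ (hermiteBasis n) (mulOp f (hermiteBasis n))) (𝓝[<] 1) (𝓝 m) := by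
  obtain ⟨μm, μp, hbot, htop, rfl⟩ := hm
  have hratio : Tendsto (fun r : ℝ => (1 - r) / (1 + r)) (𝓝[<] 1) (𝓝[>] 0) := by
    refine tendsto_nhdsWithin_iff.2 ⟨?_, ?_⟩
    · have hcont : ContinuousAt (fun r : ℝ => (1 - r) / (1 + r)) 1 :=
        ContinuousAt.div (by fun_prop) (by fun_prop) (by norm_num)
      simpa using hcont.tendsto.mono_left (nhdsWithin_le_nhds (s := Set.Iio 1))
    · filter_upwards [Ioo_mem_nhdsLT (zero_lt_one' ℝ)] with r hr
      exact div_pos (sub_pos.2 hr.2) (add_pos one_pos hr.1)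
  have hgauss := ((tendsto_sqrt_smul_integral_exp_neg_mul_sq_smul f (p := μp) (q := μm)
    (by simpa [Complex.real_smul] using htop)
    (by simpa [Complex.real_smul] using hbot)).comp hratio).const_smul (√Real.pi)⁻¹
  have hlimit : (√Real.pi)⁻¹ • (√Real.pi / 2) • (μp + μm) = 1 / 2 * μm + 1 / 2 * μp := by
    rw [div_eq_mul_inv, mul_smul, inv_smul_smul₀ (by positivity), Complex.real_smul]
    push_cast
    ring
  rw [hlimit] at hgauss
  refine hgauss.congr' ?_
  filter_upwards [Ioo_mem_nhdsLT (zero_lt_one' ℝ)] with r hr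
  have hsub : 0 < 1 - r := sub_pos.2 hr.2
  have hadd : 0 < 1 + r := add_pos one_pos hr.1
  rw [(hasSum_pow_smul_inner_hermiteBasis_mulOp f (abs_lt.2 ⟨by linarith, hr.2⟩)).tsum_eq,
    Function.comp_apply, smul_smul, smul_smul, ← one_pow 2, sq_sub_sq, one_pow,
    Real.sqrt_mul hadd.le, Real.sqrt_div hsub.le]
  congr 1
  have := Real.mul_self_sqrt hsub.le
  have : 0 < √(1 - r) := Real.sqrt_pos.2 hsub
  have : 0 < √(1 + r) := Real.sqrt_pos.2 hadd
  field_simp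
  linarith

theorem inner_hermiteBasis_mulOp_comp_oscillatorInv (f : ℝ →ᵇ ℂ) (n : ℕ) :
    inner ℂ (hermiteBasis n) ((mulOp f ∘L oscillatorInv) (hermiteBasis n))
      = (2 * n + 1 : ℝ)⁻¹ • inner ℂ (hermiteBasis n) (mulOp f (hermiteBasis n)) := by
  rw [ContinuousLinearMap.comp_apply, isDiagonal_oscillatorInv.apply_basis, map_smul,
    inner_smul_right, Complex.real_smul]
  push_cast
  rfl

theorem norm_inner_hermiteBasis_mulOp_le (f : ℝ →ᵇ ℂ) (n : ℕ) :
    ‖inner ℂ (hermiteBasis n) (mulOp f (hermiteBasis n))‖ ≤ ‖mulOp f‖ := by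
  have hnorm : ‖hermiteBasis n‖ = 1 := hermiteBasis.orthonormal.1 n
  calc ‖inner ℂ (hermiteBasis n) (mulOp f (hermiteBasis n))‖
      ≤ ‖hermiteBasis n‖ * ‖mulOp f (hermiteBasis n)‖ := norm_inner_le_norm _ _
    _ ≤ 1 * (‖mulOp f‖ * 1) := by
        rw [hnorm]
        gcongr
        exact (mulOp f).le_of_opNorm_le_of_le le_rfl hnorm.le
    _ = ‖mulOp f‖ := by rw [one_mul, mul_one]

theorem tendsto_sum_inner_hermiteBasis_mulOp_comp_oscillatorInv_div_log (f : ℝ →ᵇ ℂ) {m : ℂ}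
    (hm : HasAsymptoticMean f m) :
    Tendsto (fun n : ℕ => (∑ k ∈ Finset.range (n + 1), inner ℂ (hermiteBasis k)
      ((mulOp f ∘L oscillatorInv) (hermiteBasis k))) / (Real.log (n + 2) : ℂ)) atTop
      (𝓝 (m / 2)) := by
  simpa only [inner_hermiteBasis_mulOp_comp_oscillatorInv, Complex.real_smul, div_eq_inv_mul,
    Complex.ofReal_inv, Complex.ofReal_ofNat] using
    tendsto_inv_log_smul_sum_odd_inv_smul_of_tendsto_abel (norm_inner_hermiteBasis_mulOp_le f)
      (tendsto_abel_inner_hermiteBasis_mulOp f hm)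

end MultiplicationMean

end HarmonicDixmier

end

theorem mainTheorem8_general (ω : HarmonicDixmier.DixmierLimit)
    (f : BoundedContinuousFunction ℝ ℂ) (m : ℂ) (hm : HarmonicDixmier.HasAsymptoticMean f m) :
    HarmonicDixmier.IsBoundedInverse HarmonicDixmier.harmonicOscillator
        HarmonicDixmier.oscillatorInv ∧
      HarmonicDixmier.MemDixmierIdeal
        (HarmonicDixmier.mulOp f ∘L HarmonicDixmier.oscillatorInv) ∧
      HarmonicDixmier.dixmierTrace ω
        (HarmonicDixmier.mulOp f ∘L HarmonicDixmier.oscillatorInv) = m / 2 := by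
  have hdiag := HarmonicDixmier.isDiagonal_oscillatorInv
  have htail := (hdiag.hasReciprocalTail zero_le_one
    HarmonicDixmier.norm_two_mul_add_one_inv_le).comp_left (HarmonicDixmier.mulOp f)
  have horth := HarmonicDixmier.hermiteBasis.orthonormal
  exact ⟨HarmonicDixmier.isBoundedInverse_harmonicOscillator hdiag,
    htail.memDixmierIdeal (htail.const_nonneg horth),
    htail.dixmierTrace_eq horth ω
      (HarmonicDixmier.tendsto_sum_inner_hermiteBasis_mulOp_comp_oscillatorInv_div_log f hm)⟩

theorem mainTheorem8 (ω : HarmonicDixmier.DixmierLimit) (f : BoundedContinuousFunction ℝ ℂ)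
    (hf : UniformContinuous f) (m : ℂ) (hm : HarmonicDixmier.HasAsymptoticMean f m) :
    HarmonicDixmier.IsBoundedInverse HarmonicDixmier.harmonicOscillator
        HarmonicDixmier.oscillatorInv ∧
      HarmonicDixmier.MemDixmierIdeal
        (HarmonicDixmier.mulOp f ∘L HarmonicDixmier.oscillatorInv) ∧
      HarmonicDixmier.dixmierTrace ω
        (HarmonicDixmier.mulOp f ∘L HarmonicDixmier.oscillatorInv) = m / 2 :=
  mainTheorem8_general ω f m hm
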